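/- Let $\mathbb{F}$ be an algebraically closed field of characteristic $\ell \ge 0$, let $V$ be an $\mathbb{F}$-vector space of finite dimension $d > 4$, and let $\mathcal{G}$ be $GL(V)$, or $Sp(V)$, or $GO(V)$ (the full isometry group of a non-degenerate alternating, resp. symmetric, bilinear form on $V$). Let $G \le \mathcal{G}$ be a subgroup (for instance a Zariski closed one), let $p \neq \ell$ be a prime, and suppose that there is a finite subgroup $H \le \mathcal{G}$ with $Z(\mathcal{G})G = Z(\mathcal{G})H$ (for instance the normalized version of $G$, if finite) such that $H \le N_{\mathcal{G}}(P)$ for some subgroup $P = Z(P)E$ of $\mathcal{G}$, where $E$ is an extraspecial $p$-group (a finite $p$-group whose center has order $p$ and whose central quotient is non-trivial elementary abelian) with $d = \sqrt{|E/Z(E)|}$. (Thus, if $|E| = p^{1+2n}$, then $d = p^n$.) Then: (1) $\mathrm{Sym}^k(V)$ is reducible over $G$ (it has a nonzero proper $G$-invariant subspace) for every $k > 2$ if $p > 2$, and for every $k > 3$ if $p = 2$; (2) $\wedge^k(V)$ is reducible over $G$ for every $k$ with $2 < k < d-2$ if $p > 2$, and for every $k$ with $3 < k < d-3$ if $p =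 2$. (For $d = 5$ there is no such $k$ in (2): nothing is claimed for exterior powers in dimension $5$.) -/

import Mathlib

open scoped exteriorPower

/-- A finite `p`-group `E` is extraspecial if its center has order `p` and `E / Z(E)` is a
nontrivial elementary abelian `p`-group (equivalently, `Z(E) = [E, E] = Φ(E)` has order `p`). -/
structure IsExtraspecial (p : ℕ) (E : Type*) [Group E] : Prop where
  finite : Finite E
  isPGroup : IsPGroup p E
  card_center : Nat.card (Subgroup.center E) = p
  center_ne_top : Subgroup.center E ≠ ⊤
  commutator_le_center : commutator E ≤ Subgroup.center E
  pow_mem_center : ∀ x : E, x ^ p ∈ Subgroup.center E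

/-- The center `Z(K)` of a subgroup `K` of `M`, as a subgroup of `M`. -/
def centerOf {M : Type*} [Group M] (K : Subgroup M) : Subgroup M :=
  (Subgroup.center K).map K.subtype

section ClassicalGroups

variable {F V : Type*} [Field F] [AddCommGroup V] [Module F V]

/-- The full isometry group of a bilinear form `B` on `V`. -/
def isometryGroup (B : LinearMap.BilinForm F V) :
    Subgroup (LinearMap.GeneralLinearGroup F V) where
  carrier := {g | ∀ x y : V, B ((g : V →ₗ[F] V) x) ((g : V →ₗ[F] V) y) = B x y}
  one_mem' := fun x y => by simp
  mul_mem' := fun {a b} ha hb x y => by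
    simpa using (ha ((b : V →ₗ[F] V) x) ((b : V →ₗ[F] V) y)).trans (hb x y)
  inv_mem' := fun {a} ha x y => by
    have h : ∀ z : V, (a : V →ₗ[F] V) (((a⁻¹ : LinearMap.GeneralLinearGroup F V) :
        V →ₗ[F] V) z) = z := fun z => by
      rw [← Module.End.mul_apply, ← Units.val_mul, mul_inv_cancel]; rfl
    rw [← ha, h, h]

/-- `𝒢` is one of the groups `GL(V)`, `Sp(V)`, `GO(V)`: the full general linear group, or the full
isometry group of a non-degenerate alternating, resp. symmetric, bilinear form on `V`. -/
def IsClassicalGroup (𝒢 : Subgroup (LinearMap.GeneralLinearGroup F V)) : Prop :=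
  𝒢 = ⊤ ∨
  (∃ B : LinearMap.BilinForm F V, B.IsAlt ∧ B.Nondegenerate ∧ 𝒢 = isometryGroup B) ∨
  (∃ B : LinearMap.BilinForm F V, B.IsSymm ∧ B.Nondegenerate ∧ 𝒢 = isometryGroup B)

/-- Up to scalars of `𝒢`, the subgroup `G` agrees with a finite subgroup `H` of `𝒢` (for instance
its normalized version) that normalizes some `P = Z(P)E ≤ 𝒢` with `E` an extraspecial `p`-group
such that `dim V = √|E/Z(E)|`. -/
def NormalizesExtraspecial (p : ℕ) (𝒢 G : Subgroup (LinearMap.GeneralLinearGroup F V)) : Prop :=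
  ∃ H P E : Subgroup (LinearMap.GeneralLinearGroup F V),
    H ≤ 𝒢 ∧ centerOf 𝒢 ⊔ G = centerOf 𝒢 ⊔ H ∧ Finite H ∧
    P ≤ 𝒢 ∧ H ≤ Subgroup.normalizer (P : Set (LinearMap.GeneralLinearGroup F V)) ∧
    E ≤ P ∧ P = centerOf P ⊔ E ∧ IsExtraspecial p E ∧
    Module.finrank F V ^ 2 = Nat.card (E ⧸ Subgroup.center E)

end ClassicalGroups

section Powers

variable (F V : Type*) [Field F] [AddCommGroup V] [Module F V]

/-- The symmetric power `Sym^k(V)`: the degree `k` component of the symmetric algebra of `V`. -/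
abbrev symPower (k : ℕ) : Submodule F (SymmetricAlgebra F V) :=
  LinearMap.range (SymmetricAlgebra.ι F V) ^ k

variable {F V} in
/-- The algebra endomorphism of the symmetric algebra induced by an endomorphism of `V`. -/
noncomputable def symAlgMap (f : V →ₗ[F] V) : SymmetricAlgebra F V →ₐ[F] SymmetricAlgebra F V :=
  SymmetricAlgebra.lift (SymmetricAlgebra.ι F V ∘ₗ f)

variable {F V} in
theorem symAlgMap_mem (f : V →ₗ[F] V) (k : ℕ) (x : SymmetricAlgebra F V)
    (hx : x ∈ symPower F V k) : (symAlgMap f).toLinearMap x ∈ symPower F V k := by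
  have h : (symPower F V k).map (symAlgMap f).toLinearMap ≤ symPower F V k := by
    rw [Submodule.map_pow]
    refine pow_le_pow_left' ?_ k
    rintro _ ⟨_, ⟨v, rfl⟩, rfl⟩
    exact ⟨f v, by simp [symAlgMap]⟩
  exact h ⟨x, hx, rfl⟩

/-- The natural representation of `GL(V)` on `Sym^k(V)`. -/
noncomputable def symRep (k : ℕ) :
    Representation F (LinearMap.GeneralLinearGroup F V) (symPower F V k) where
  toFun g := (symAlgMap (g : V →ₗ[F] V)).toLinearMap.restrict (symAlgMap_mem _ k)
  map_one' := by
    have h : symAlgMap (1 : V →ₗ[F] V) = AlgHom.id F (SymmetricAlgebra F V) := by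
      apply SymmetricAlgebra.algHom_ext
      ext v
      simp [symAlgMap]
    ext x
    simp [LinearMap.restrict_apply, h]
  map_mul' a b := by
    have h : symAlgMap ((a : V →ₗ[F] V) * (b : V →ₗ[F] V)) =
        (symAlgMap (a : V →ₗ[F] V)).comp (symAlgMap (b : V →ₗ[F] V)) := by
      apply SymmetricAlgebra.algHom_ext
      ext v
      simp [symAlgMap]
    ext x
    simp [LinearMap.restrict_apply, h]

/-- The natural representation of `GL(V)` on `⋀^k(V)`. -/
noncomputable def extRep (k : ℕ) :
    Representation F (LinearMap.GeneralLinearGroup F V) (⋀[F]^k V) where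
  toFun g := exteriorPower.map k (g : V →ₗ[F] V)
  map_one' := exteriorPower.map_id
  map_mul' a b := by
    rw [Units.val_mul, Module.End.mul_eq_comp, Module.End.mul_eq_comp]
    ext v
    simp

variable {F V} in
/-- The subgroup `G` acts reducibly: there is a nonzero proper `G`-invariant subspace. -/
def ReducibleOver {M W : Type*} [Group M] [AddCommGroup W] [Module F W]
    (ρ : Representation F M W) (G : Subgroup M) : Prop :=
  ∃ U : Submodule F W, U ≠ ⊥ ∧ U ≠ ⊤ ∧ ∀ g ∈ G, ∀ u ∈ U, ρ g u ∈ U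

end Powers

/-!
Modulo scalars `G` normalizes `P = Z(P)E`. Since `d ^ 2 = |E / Z(E)|`, the group `E` acts on `V` by
the Schrödinger representation: there are an elementary abelian `p`-group `I` and a basis `e`
indexed by `I` such that `E` consists, up to scalars, of the Weyl operators `e i ↦ χ i • e (i + b)`
(`IsExtraspecial.exists_weyl_basis`). It comes from two complementary Lagrangian subgroups of
`E / Z(E)` for the commutator pairing (`exists_complementary_lagrangians`): the basis consists of
eigenvectors of one Lagrangian, which the other one permutes. The central elements of `P` are
scalars, so conjugation by `G` permutes the Weyl operators up to scalars
(`NormalizesExtraspecial.exists_basis`).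

The operators inverting every Weyl operator by conjugation are, up to scalars, the reflected ones
`e i ↦ χ i • e (b - i)` (`InvertsWeyl.exists_eq_smul`). Normalized to trace one if `p` is odd, or to
be involutions if `p = 2`, they form a finite family `B j` that `G` permutes by conjugation. Let `Φ`
be the functor that extends an endomorphism of `V` to the symmetric or to the exterior algebra. Then
`T s = ∑ j, Φ (1 + s • B j)` commutes with `G` for every scalar `s`, and as soon as one `T s` is not
scalar in degree `k`, any of its eigenspaces there is a nonzero proper invariant subspace
(`FunctorialAlgebra.reducibleOver_of_family`).

To see that `T s` is not scalar, apply it to a monomial in basis vectors with indices `Q ++ R`, where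
`Q` has sum zero and length `3` if `p` is odd and `4` if `p = 2`. In the part of the result where
exactly the factors in `Q` have been moved, the characters cancel and there remains a nonzero
multiple of `∑ h, ∏ q ∈ Q, e (h - q)`, where `h` runs over all of `I` if `p ≤ 3`, and is `0` if
`p ≥ 5`. A coordinate projection that kills the indices in `Q` and preserves those in `R` annihilates
the monomial itself but, for a suitable choice of `Q` and `R`, not this part
(`FunctorialAlgebra.exists_sum_map_ne_smul`). For symmetric powers such a choice exists as soon as
`k` is at least the length of `Q`. For exterior powers the moved factors must miss both `Q` and `R`,
which is possible for `k ≤ d - 3`, respectively `k ≤ d - 4`. There `Q` is a subgroup of `I` if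
`p ≤ 3`, and translations by it permute the moved factors evenly, so that the terms of the sum do
not cancel.
-/

/-! ### Complementary Lagrangians of an alternating pairing -/

section Pairing

variable {M F : Type*} [CommGroup M] [Field F]

/-- The subgroup of elements that pair trivially with `X`, for a pairing `c` on an abelian
group with values in `Fˣ`. -/
def pairingPerp (c : M →* M →* Fˣ) (X : Subgroup M) : Subgroup M where
  carrier := {y | ∀ x ∈ X, c y x = 1}
  one_mem' := fun x _ => by simp
  mul_mem' := fun {a b} ha hb x hx => by simp [ha x hx, hb x hx]
  inv_mem' := fun {a} ha x hx => by simp [ha x hx]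

variable {c : M →* M →* Fˣ}

theorem mem_pairingPerp {X : Subgroup M} {y : M} :
    y ∈ pairingPerp c X ↔ ∀ x ∈ X, c y x = 1 := Iff.rfl

theorem le_pairingPerp_sup {X Y Z : Subgroup M} (hX : Z ≤ pairingPerp c X)
    (hY : Z ≤ pairingPerp c Y) : Z ≤ pairingPerp c (X ⊔ Y) := by
  intro z hz
  have h : X ⊔ Y ≤ (c z).ker := sup_le (fun x hx => hX hz x hx) (fun x hx => hY hz x hx)
  exact h

theorem pairing_swap (halt : ∀ x, c x x = 1) (x y : M) : c x y * c y x = 1 := by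
  have h := halt (x * y)
  simpa [halt] using h

theorem pairing_eq_one_comm (halt : ∀ x, c x x = 1) {x y : M} (h : c x y = 1) : c y x = 1 := by
  simpa [h] using pairing_swap halt x y

theorem le_pairingPerp_comm (halt : ∀ x, c x x = 1) {X Y : Subgroup M}
    (h : X ≤ pairingPerp c Y) : Y ≤ pairingPerp c X :=
  fun y hy _ hx => pairing_eq_one_comm halt (h hx y hy)

/-- An isotropic subgroup stays isotropic when an element of its orthogonal is adjoined. -/
theorem sup_zpowers_isotropic (halt : ∀ x, c x x = 1) {X : Subgroup M}
    (hX : X ≤ pairingPerp c X) {y : M} (hy : y ∈ pairingPerp c X) :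
    X ⊔ Subgroup.zpowers y ≤ pairingPerp c (X ⊔ Subgroup.zpowers y) := by
  have h1 : Subgroup.zpowers y ≤ pairingPerp c X := by simpa using hy
  refine le_pairingPerp_sup (sup_le hX h1) (sup_le (le_pairingPerp_comm halt h1) ?_)
  rw [Subgroup.zpowers_le]
  rintro _ ⟨n, rfl⟩
  simp [halt]

theorem bijective_of_injective_pairing [Finite M] [HasEnoughRootsOfUnity F (Monoid.exponent M)]
    (hc : Function.Injective c) : Function.Bijective c := by
  have : Finite (M →* Fˣ) := Finite.of_equiv _
    (CommGroup.monoidHom_mulEquiv_of_hasEnoughRootsOfUnity M F).some.symm.toEquiv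
  exact hc.bijective_of_nat_card_le (CommGroup.card_monoidHom_of_hasEnoughRootsOfUnity M F).le

theorem pairingPerp_pairingPerp [Finite M] [HasEnoughRootsOfUnity F (Monoid.exponent M)]
    (hc : Function.Injective c) (halt : ∀ x, c x x = 1) (X : Subgroup M) :
    pairingPerp c (pairingPerp c X) = X := by
  ext x
  rw [← CommGroup.forall_monoidHom_apply_eq_one_iff (M := F) X x]
  constructor
  · intro h φ hφ
    obtain ⟨y, rfl⟩ := (bijective_of_injective_pairing hc).2 φ
    exact pairing_eq_one_comm halt (h y hφ)
  · intro h y hy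
    exact pairing_eq_one_comm halt (h (c y) hy)

/-- A nondegenerate alternating pairing on a finite elementary abelian `p`-group splits the group
into two complementary isotropic subgroups. -/
theorem exists_complementary_lagrangians [Finite M]
    [HasEnoughRootsOfUnity F (Monoid.exponent M)] {p : ℕ} (hp : p.Prime)
    (hM : ∀ x : M, x ^ p = 1) (hc : Function.Injective c) (halt : ∀ x, c x x = 1) :
    ∃ L L' : Subgroup M, L ≤ pairingPerp c L ∧ L' ≤ pairingPerp c L' ∧
      L ⊓ L' = ⊥ ∧ L ⊔ L' = ⊤ := by
  obtain ⟨L, hL, hLmax⟩ := (Set.toFinite {X : Subgroup M | X ≤ pairingPerp c X}).exists_maximal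
    ⟨⊥, show ⊥ ≤ pairingPerp c ⊥ from bot_le⟩
  have hLperp : pairingPerp c L ≤ L := fun x hx =>
    hLmax (sup_zpowers_isotropic halt hL hx) le_sup_left
      (Subgroup.mem_sup_right (Subgroup.mem_zpowers x))
  obtain ⟨L', ⟨hL', hd⟩, hmax⟩ :=
    (Set.toFinite {X : Subgroup M | X ≤ pairingPerp c X ∧ L ⊓ X = ⊥}).exists_maximal
      ⟨⊥, show ⊥ ≤ pairingPerp c ⊥ from bot_le, inf_bot_eq _⟩
  -- Maximality of `L'` forces its orthogonal into `L ⊔ L'`; then take orthogonals once more.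
  have key : pairingPerp c L' ≤ L ⊔ L' := by
    intro y hy
    by_contra hyn
    have hne : L ⊓ (L' ⊔ Subgroup.zpowers y) ≠ ⊥ := by
      intro h0
      exact hyn (Subgroup.mem_sup_right
        (hmax ⟨sup_zpowers_isotropic halt hL' hy, h0⟩ le_sup_left
          (Subgroup.mem_sup_right (Subgroup.mem_zpowers y))))
    obtain ⟨⟨a, haL, ha⟩, ha1⟩ := Subgroup.ne_bot_iff_exists_ne_one.mp hne
    replace ha1 : a ≠ 1 := fun h => ha1 (Subtype.ext h)
    obtain ⟨x', hx', z, hz, hxz⟩ := Subgroup.mem_sup.mp ha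
    obtain ⟨m, rfl⟩ := Subgroup.mem_zpowers_iff.mp hz
    have hyp : y ^ (p : ℤ) = 1 := by exact_mod_cast hM y
    by_cases hpm : (p : ℤ) ∣ m
    · obtain ⟨t, rfl⟩ := hpm
      rw [zpow_mul, hyp, one_zpow, mul_one] at hxz
      have : a ∈ L ⊓ L' := ⟨haL, hxz ▸ hx'⟩
      rw [hd, Subgroup.mem_bot] at this
      exact ha1 this
    · have hcop : IsCoprime (p : ℤ) m :=
        (Nat.prime_iff_prime_int.mp hp).coprime_iff_not_dvd.mpr hpm
      obtain ⟨u, v, huv⟩ := hcop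
      have hym : y ^ m ∈ L ⊔ L' := by
        have : y ^ m = x'⁻¹ * a := by rw [← hxz]; group
        rw [this]
        exact mul_mem (inv_mem (Subgroup.mem_sup_right hx')) (Subgroup.mem_sup_left haL)
      have hy' : y = (y ^ m) ^ v := by
        conv_lhs => rw [← zpow_one y, ← huv, zpow_add, mul_comm u, zpow_mul, hyp, one_zpow,
          one_mul, mul_comm v, zpow_mul]
      exact hyn (hy' ▸ zpow_mem hym v)
  have hbot : pairingPerp c (L ⊔ L') = ⊥ := by
    rw [eq_bot_iff, ← hd]
    intro x hx
    refine ⟨hLperp fun y hy => hx y (Subgroup.mem_sup_left hy), ?_⟩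
    rw [← pairingPerp_pairingPerp hc halt L']
    exact fun y hy => hx y (key hy)
  refine ⟨L, L', hL, hL', hd, ?_⟩
  rw [← pairingPerp_pairingPerp hc halt (L ⊔ L'), hbot]
  ext x
  simp [mem_pairingPerp]

end Pairing

/-! ### Common eigenvectors and the central character -/

section Eigenvectors

variable {F V : Type*} [Field F] [IsAlgClosed F] [AddCommGroup V] [Module F V]
  [FiniteDimensional F V]

theorem exists_common_eigenvector (S : Set (Module.End F V))
    (hS : ∀ f ∈ S, ∀ g ∈ S, Commute f g) (U : Submodule F V) (hU : U ≠ ⊥)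
    (hSU : ∀ f ∈ S, ∀ u ∈ U, f u ∈ U) :
    ∃ v ∈ U, v ≠ 0 ∧ ∀ f ∈ S, ∃ k : F, f v = k • v := by
  induction hn : Module.finrank F U using Nat.strong_induction_on generalizing U with
  | _ n ih =>
    by_cases hsc : ∀ f ∈ S, ∃ k : F, ∀ u ∈ U, f u = k • u
    · obtain ⟨v, hv, hv0⟩ := Submodule.exists_mem_ne_zero_of_ne_bot hU
      exact ⟨v, hv, hv0, fun f hf => (hsc f hf).imp fun k hk => hk v hv⟩
    · push Not at hsc
      obtain ⟨f, hf, hfn⟩ := hsc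
      have : Nontrivial U := Submodule.nontrivial_iff_ne_bot.mpr hU
      obtain ⟨μ, hμ⟩ := Module.End.exists_eigenvalue (f.restrict (hSU f hf))
      obtain ⟨w, hw⟩ := hμ.exists_hasEigenvector
      have hfw : f w = μ • (w : V) := by
        simpa using congrArg Subtype.val hw.apply_eq_smul
      have hw0 : (w : V) ≠ 0 := fun h => hw.2 (Subtype.ext h)
      have hmem : ∀ u, u ∈ U ⊓ Module.End.eigenspace f μ ↔ u ∈ U ∧ f u = μ • u := fun u => by
        simp
      obtain ⟨u, hu, hfu⟩ := hfn μ
      have hlt : U ⊓ Module.End.eigenspace f μ < U :=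
        lt_of_le_of_ne inf_le_left fun h => hfu ((hmem u).mp (h.symm ▸ hu)).2
      obtain ⟨v, hv, hv0, hv'⟩ := ih _ (hn ▸ Submodule.finrank_lt_finrank_of_lt hlt)
        (U ⊓ Module.End.eigenspace f μ)
        (fun h => hw0 (by
          have : (w : V) ∈ U ⊓ Module.End.eigenspace f μ := (hmem w).mpr ⟨w.2, hfw⟩
          rwa [h, Submodule.mem_bot] at this))
        (fun g hg u hu => by
          rw [hmem] at hu ⊢
          refine ⟨hSU g hg u hu.1, ?_⟩
          rw [← Module.End.mul_apply, (hS f hf g hg).eq, Module.End.mul_apply, hu.2, map_smul])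
        rfl
      exact ⟨v, ((hmem v).mp hv).1, hv0, hv'⟩

variable {E : Type*} [Group E] (τ : E →* Module.End F V)

theorem exists_eigencharacter (K : Subgroup E) (hK : ∀ x ∈ K, ∀ y ∈ K, x * y = y * x)
    (U : Submodule F V) (hU : U ≠ ⊥) (hKU : ∀ x ∈ K, ∀ u ∈ U, τ x u ∈ U) :
    ∃ v ∈ U, v ≠ 0 ∧ ∃ ρ : K →* Fˣ, ∀ x : K, τ x v = (ρ x : F) • v := by
  obtain ⟨v, hvU, hv0, hv⟩ := exists_common_eigenvector (τ '' K) (by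
    rintro _ ⟨x, hx, rfl⟩ _ ⟨y, hy, rfl⟩
    simp only [Commute, SemiconjBy, ← map_mul, hK x hx y hy]) U hU (by
    rintro _ ⟨x, hx, rfl⟩
    exact hKU x hx)
  choose r hr using fun x : K => hv _ ⟨x, x.2, rfl⟩
  let ρ : K →* F :=
    { toFun := r
      map_one' := smul_left_injective F hv0 (by simpa using (hr 1).symm)
      map_mul' := fun x y => smul_left_injective F hv0 (by
        have := hr (x * y)
        simp only [Subgroup.coe_mul, map_mul, Module.End.mul_apply, hr y, map_smul, hr x] at this
        simp only [← this, smul_smul, mul_comm]) }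
  exact ⟨v, hvU, hv0, ρ.toHomUnits, hr⟩

variable {τ}

/-- In a faithful representation in characteristic different from `p`, the center of an
extraspecial `p`-group acts faithfully by scalars on a nonzero subrepresentation. -/
theorem IsExtraspecial.exists_central_character {p : ℕ} (hp : p.Prime) (hpF : (p : F) ≠ 0)
    (hE : IsExtraspecial p E) (hτ : Function.Injective τ) :
    ∃ ζ : Subgroup.center E →* Fˣ, Function.Injective ζ ∧
      ∃ U : Submodule F V, U ≠ ⊥ ∧ (∀ (x : E), ∀ u ∈ U, τ x u ∈ U) ∧
        ∀ (z : Subgroup.center E), ∀ u ∈ U, τ z u = (ζ z : F) • u := by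
  have := hE.finite
  have hfact : Fact (Nat.card (Subgroup.center E)).Prime := ⟨by rw [hE.card_center]; exact hp⟩
  have : Nontrivial (Subgroup.center E) :=
    Finite.one_lt_card_iff_nontrivial.mp hfact.out.one_lt
  obtain ⟨z, hz⟩ := exists_ne (1 : Subgroup.center E)
  have hzp : (z : E) ^ p = 1 := by
    have : z ^ p = 1 := by rw [← hE.card_center]; exact pow_card_eq_one'
    exact_mod_cast congrArg Subtype.val this
  -- If `z` fixed a vector `v ≠ 0` of `ker N`, then `N v = p v ≠ 0`; so `z` acts nontrivially there.
  let N : Module.End F V := ∑ j ∈ Finset.range p, τ z ^ j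
  have hN0 : N * (τ z - 1) = 0 := by
    rw [geom_sum_mul, ← map_pow, hzp, map_one, sub_self]
  have hτz : τ z ≠ 1 := fun h => hz (Subtype.ext (hτ (by simpa using h)))
  have hcomm : ∀ x : E, Commute (τ x) (τ z) := fun x => by
    simp only [Commute, SemiconjBy, ← map_mul]
    rw [Subgroup.mem_center_iff.mp z.2 x]
  have hcommN : ∀ x : E, Commute (τ x) N := fun x =>
    Commute.sum_right _ _ _ fun j _ => (hcomm x).pow_right j
  obtain ⟨v, hvN, hv0, ζ, hζ⟩ := exists_eigencharacter τ (Subgroup.center E)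
    (fun x _ y hy => Subgroup.mem_center_iff.mp hy x) (LinearMap.ker N)
    (fun h => hτz (by
      rw [LinearMap.ker_eq_bot'] at h
      ext v
      rw [← sub_eq_zero]
      exact h _ (by simpa using congrArg (fun f => f v) hN0)))
    (fun x _ u hu => by
      rw [LinearMap.mem_ker] at hu ⊢
      rw [← Module.End.mul_apply, ← (hcommN x).eq, Module.End.mul_apply, hu, map_zero])
  have hζz : ζ z ≠ 1 := fun h => by
    have hzv : τ z v = v := by simpa [h] using hζ z
    have hj : ∀ j : ℕ, (τ z ^ j) v = v := fun j => by
      rw [Module.End.pow_apply]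
      exact Function.iterate_fixed hzv j
    have : (p : F) • v = 0 := by
      rw [LinearMap.mem_ker] at hvN
      simpa [N, LinearMap.sum_apply, hj, ← Nat.cast_smul_eq_nsmul F] using hvN
    exact (smul_ne_zero hpF hv0) this
  refine ⟨ζ, ?_, ⨅ z : Subgroup.center E, LinearMap.ker (τ z - (ζ z : F) • 1), ?_, ?_, ?_⟩
  · rw [← MonoidHom.ker_eq_bot_iff]
    exact (ζ.ker.eq_bot_or_eq_top_of_prime_card).resolve_right fun h =>
      hζz ((h ▸ Subgroup.mem_top z : z ∈ ζ.ker))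
  · refine (Submodule.ne_bot_iff _).mpr ⟨v, ?_, hv0⟩
    simp [Submodule.mem_iInf, -Subtype.forall, hζ]
  · intro x u hu
    simp only [Submodule.mem_iInf, LinearMap.mem_ker, LinearMap.sub_apply, LinearMap.smul_apply,
      Module.End.one_apply, sub_eq_zero] at hu ⊢
    intro z
    rw [← Module.End.mul_apply, ← map_mul, ← Subgroup.mem_center_iff.mp z.2 x, map_mul,
      Module.End.mul_apply, hu z, map_smul]
  · intro z u hu
    simp only [Submodule.mem_iInf, LinearMap.mem_ker, LinearMap.sub_apply, LinearMap.smul_apply,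
      Module.End.one_apply, sub_eq_zero] at hu
    exact hu z

end Eigenvectors

/-! ### The commutator pairing -/

section CommutatorPairing

open scoped commutatorElement

variable {E M F : Type*} [Group E] [CommGroup M] [Field F]

theorem commutatorElement_mem_center (hE : commutator E ≤ Subgroup.center E) (x y : E) :
    ⁅x, y⁆ ∈ Subgroup.center E :=
  hE (Subgroup.commutator_mem_commutator (Subgroup.mem_top x) (Subgroup.mem_top y))

/-- For a group whose commutators are central, the pairing `(x, y) ↦ ζ ⁅x, y⁆` attached to a
character `ζ` of the center. -/
def commutatorPairing (hE : commutator E ≤ Subgroup.center E)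
    (ζ : Subgroup.center E →* Fˣ) : E →* E →* Fˣ :=
  MonoidHom.mk' (fun x => MonoidHom.mk' (fun y => ζ ⟨⁅x, y⁆, commutatorElement_mem_center hE x y⟩)
    (fun y y' => by
      rw [← map_mul]
      congr 1
      ext
      have h := Subgroup.mem_center_iff.mp (commutatorElement_mem_center hE x y') y
      calc ⁅x, y * y'⁆ = ⁅x, y⁆ * (y * ⁅x, y'⁆ * y⁻¹) := by
            simp only [commutatorElement_def]; group
        _ = ⁅x, y⁆ * ⁅x, y'⁆ := by rw [h, mul_inv_cancel_right]))
    (fun x x' => by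
      ext y
      simp only [MonoidHom.mk'_apply, MonoidHom.mul_apply]
      rw [← map_mul]
      congr 2
      ext
      have h := Subgroup.mem_center_iff.mp (commutatorElement_mem_center hE x' y) x
      have h2 := Subgroup.mem_center_iff.mp (commutatorElement_mem_center hE x y) ⁅x', y⁆
      calc ⁅x * x', y⁆ = (x * ⁅x', y⁆ * x⁻¹) * ⁅x, y⁆ := by
            simp only [commutatorElement_def]; group
        _ = ⁅x, y⁆ * ⁅x', y⁆ := by rw [h, mul_inv_cancel_right, h2])

theorem commutatorPairing_apply (hE : commutator E ≤ Subgroup.center E)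
    (ζ : Subgroup.center E →* Fˣ) (x y : E) : commutatorPairing hE ζ x y =
      ζ ⟨⁅x, y⁆, commutatorElement_mem_center hE x y⟩ := rfl

theorem commutatorPairing_eq_one_iff (hE : commutator E ≤ Subgroup.center E)
    {ζ : Subgroup.center E →* Fˣ} (hζ : Function.Injective ζ) (x y : E) :
    commutatorPairing hE ζ x y = 1 ↔ x * y = y * x := by
  rw [commutatorPairing_apply, map_eq_one_iff ζ hζ, ← commutatorElement_eq_one_iff_mul_comm,
    ← Subtype.coe_inj, Subgroup.coe_one]

/-- The commutator pairing descends to the central quotient. -/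
theorem exists_pairing_on_quotient (hE : commutator E ≤ Subgroup.center E)
    {ζ : Subgroup.center E →* Fˣ} (hζ : Function.Injective ζ) {π : E →* M}
    (hπ : Function.Surjective π) (hker : π.ker = Subgroup.center E) :
    ∃ c : M →* M →* Fˣ, ∀ x y, c (π x) (π y) = commutatorPairing hE ζ x y := by
  have h1 : ∀ x, π.ker ≤ (commutatorPairing hE ζ x).ker := fun x y hy => by
    rw [hker] at hy
    exact (commutatorPairing_eq_one_iff hE hζ x y).mpr (Subgroup.mem_center_iff.mp hy x)
  let g : E → M →* Fˣ := fun x => π.liftOfSurjective hπ ⟨_, h1 x⟩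
  have hg : ∀ x y, g x (π y) = commutatorPairing hE ζ x y := fun x y =>
    π.liftOfRightInverse_comp_apply _ (Function.rightInverse_surjInv hπ) ⟨_, h1 x⟩ y
  let g' : E →* M →* Fˣ := MonoidHom.mk' g fun x x' => by
    ext m
    obtain ⟨y, rfl⟩ := hπ m
    simp [hg]
  have h2 : π.ker ≤ g'.ker := fun x hx => by
    rw [hker] at hx
    rw [MonoidHom.mem_ker]
    ext m
    obtain ⟨y, rfl⟩ := hπ m
    have := (commutatorPairing_eq_one_iff hE hζ x y).mpr (Subgroup.mem_center_iff.mp hx y).symm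
    simp [g', hg, this]
  refine ⟨π.liftOfSurjective hπ ⟨g', h2⟩, fun x y => ?_⟩
  rw [← hg]
  exact congrArg (fun φ : M →* Fˣ => φ (π y))
    (π.liftOfRightInverse_comp_apply _ (Function.rightInverse_surjInv hπ) ⟨g', h2⟩ x)

end CommutatorPairing

section CrossPairing

variable {M F : Type*} [CommGroup M] [Field F] {c : M →* M →* Fˣ} {L L' : Subgroup M}

/-- The pairing between two subgroups, as a map from the first to the characters of the second. -/
def crossPairing (c : M →* M →* Fˣ) (L L' : Subgroup M) : L →* L' →* Fˣ :=
  (MonoidHom.domRestrictHom L' Fˣ).comp (c.comp L.subtype)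

theorem crossPairing_apply (l : L) (b : L') : crossPairing c L L' l b = c l b := rfl

theorem crossPairing_injective (hc : Function.Injective c) (hL : L ≤ pairingPerp c L)
    (hsup : L ⊔ L' = ⊤) : Function.Injective (crossPairing c L L') := by
  rw [injective_iff_map_eq_one]
  intro l hl
  have : (⊤ : Subgroup M) ≤ (c l).ker := hsup ▸ sup_le (fun x hx => hL l.2 x hx)
    (fun x hx => by simpa [crossPairing_apply] using DFunLike.congr_fun hl (⟨x, hx⟩ : L'))
  refine Subtype.ext (hc ?_)
  ext x
  simpa using this (Subgroup.mem_top x)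

variable [Finite M] [HasEnoughRootsOfUnity F (Monoid.exponent M)]

theorem card_monoidHom_subgroup (X : Subgroup M) : Nat.card (X →* Fˣ) = Nat.card X := by
  have := HasEnoughRootsOfUnity.of_dvd F (Monoid.exponent_submonoid_dvd X.toSubmonoid)
  exact CommGroup.card_monoidHom_of_hasEnoughRootsOfUnity X F

theorem finite_monoidHom_subgroup (X : Subgroup M) : Finite (X →* Fˣ) := by
  have := HasEnoughRootsOfUnity.of_dvd F (Monoid.exponent_submonoid_dvd X.toSubmonoid)
  exact Finite.of_equiv _
    (CommGroup.monoidHom_mulEquiv_of_hasEnoughRootsOfUnity X F).some.symm.toEquiv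

theorem card_eq_of_lagrangians (hc : Function.Injective c) (hL : L ≤ pairingPerp c L)
    (hL' : L' ≤ pairingPerp c L') (hsup : L ⊔ L' = ⊤) : Nat.card L = Nat.card L' := by
  have := finite_monoidHom_subgroup (F := F) L
  have := finite_monoidHom_subgroup (F := F) L'
  refine le_antisymm ?_ ?_
  · exact (Nat.card_le_card_of_injective _ (crossPairing_injective hc hL hsup)).trans_eq
      (card_monoidHom_subgroup L')
  · exact (Nat.card_le_card_of_injective _
      (crossPairing_injective hc hL' (sup_comm L L' ▸ hsup))).trans_eq (card_monoidHom_subgroup L)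

theorem crossPairing_surjective (hc : Function.Injective c) (hL : L ≤ pairingPerp c L)
    (hL' : L' ≤ pairingPerp c L') (hsup : L ⊔ L' = ⊤) :
    Function.Surjective (crossPairing c L L') := by
  have := finite_monoidHom_subgroup (F := F) L'
  exact ((crossPairing_injective hc hL hsup).bijective_of_nat_card_le
    ((card_monoidHom_subgroup L').trans (card_eq_of_lagrangians hc hL hL' hsup).symm).le).2

theorem card_lagrangian_sq (hc : Function.Injective c) (hL : L ≤ pairingPerp c L)
    (hL' : L' ≤ pairingPerp c L') (hinf : L ⊓ L' = ⊥) (hsup : L ⊔ L' = ⊤) :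
    Nat.card L' ^ 2 = Nat.card M := by
  have h := Subgroup.isComplement'_of_disjoint_and_mul_eq_univ (disjoint_iff.mpr hinf)
    (by rw [← Subgroup.mul_normal, hsup, Subgroup.coe_top])
  rw [← h.card_mul_card, card_eq_of_lagrangians hc hL hL' hsup, sq]

end CrossPairing

/-! ### The Schrödinger model of an extraspecial group -/

section SchrodingerModel

variable {F V I : Type*} [Field F] [AddCommGroup V] [Module F V] [AddCommGroup I]

/-- The Weyl operator `e i ↦ χ i • e (i + b)` of a basis `e` indexed by an abelian group. -/
noncomputable def weylOp (e : Module.Basis I F V) (χ : AddChar I F) (b : I) : Module.End F V :=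
  e.constr F fun i => χ i • e (i + b)

@[simp]
theorem weylOp_apply (e : Module.Basis I F V) (χ : AddChar I F) (b i : I) :
    weylOp e χ b (e i) = χ i • e (i + b) := by
  simp [weylOp]

theorem repr_weylOp_zero (e : Module.Basis I F V) (χ : AddChar I F) (v : V) (i : I) :
    e.repr (weylOp e χ 0 v) i = χ i * e.repr v i := by
  have : e.coord i ∘ₗ weylOp e χ 0 = χ i • e.coord i := e.ext fun j => by
    simp only [LinearMap.comp_apply, weylOp_apply, add_zero, map_smul, Module.Basis.coord_apply,
      Module.Basis.repr_self, LinearMap.smul_apply, smul_eq_mul]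
    rcases eq_or_ne j i with rfl | h
    · rfl
    · simp [Finsupp.single_eq_of_ne' h]
  exact LinearMap.congr_fun this v

end SchrodingerModel

section Existence

open scoped commutatorElement

universe u

variable {F V : Type*} [Field F] [IsAlgClosed F] [AddCommGroup V] [Module F V]
  [FiniteDimensional F V] {E : Type u} [Group E] {τ : E →* Module.End F V}

/-- For complementary isotropic subgroups `L`, `L'` of the central quotient `M` there are vectors
indexed by `L'` which the lifts of `L'` permute up to scalars, and on which the lifts of `L` act
through pairwise distinct characters. -/
theorem exists_weyl_vectors {M : Type*} [CommGroup M] (hE : commutator E ≤ Subgroup.center E)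
    {ζ : Subgroup.center E →* Fˣ} (hζ : Function.Injective ζ) {π : E →* M}
    (hπ : Function.Surjective π) (hker : π.ker = Subgroup.center E)
    {U : Submodule F V} (hU : U ≠ ⊥) (hUE : ∀ x : E, ∀ u ∈ U, τ x u ∈ U)
    (hUζ : ∀ z : Subgroup.center E, ∀ u ∈ U, τ z u = (ζ z : F) • u)
    {c : M →* M →* Fˣ} (hc : ∀ x y, c (π x) (π y) = commutatorPairing hE ζ x y)
    {L L' : Subgroup M} (hL : L ≤ pairingPerp c L) (hL' : L' ≤ pairingPerp c L') :
    ∃ (e : L' → V) (ρ : L.comap π →* Fˣ) (ρ' : L'.comap π →* Fˣ),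
      (∀ b, e b ≠ 0) ∧
      (∀ (x : L'.comap π) (b : L'), τ x (e b) = (ρ' x : F) • e (⟨π x, x.2⟩ * b)) ∧
      ∀ (a : L.comap π) (b : L'), τ a (e b) = ((ρ a : F) * c (π a) b) • e b := by
  have hcommK : ∀ K : Subgroup M, K ≤ pairingPerp c K →
      ∀ x ∈ K.comap π, ∀ y ∈ K.comap π, x * y = y * x := fun K hK x hx y hy => by
    rw [← commutatorPairing_eq_one_iff hE hζ, ← hc]
    exact hK hx _ hy
  obtain ⟨v, hvU, hv0, ρ, hρ⟩ := exists_eigencharacter τ (L.comap π) (hcommK L hL) U hU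
    fun x _ => hUE x
  obtain ⟨w, hwU, hw0, ρ', hρ'⟩ := exists_eigencharacter τ (L'.comap π) (hcommK L' hL') U hU
    fun x _ => hUE x
  have hzL' : ∀ z : Subgroup.center E, (z : E) ∈ L'.comap π := fun z => by
    have : π z = 1 := by rw [← MonoidHom.mem_ker, hker]; exact z.2
    rw [Subgroup.mem_comap, this]
    exact one_mem _
  have hρ'z : ∀ z : Subgroup.center E, ρ' ⟨z, hzL' z⟩ = ζ z := fun z =>
    Units.ext (smul_left_injective F hw0 (by
      simp only
      rw [← hρ' ⟨z, hzL' z⟩, hUζ z w hwU]))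
  -- Dividing `τ x v` by `ρ' x` makes it independent of the lift `x` of an element of `L'`,
  -- since `ρ'` restricts to `ζ` on the center.
  let s : L' → L'.comap π := fun b =>
    ⟨Function.surjInv hπ b, by simp [Function.surjInv_eq hπ]⟩
  have hs : ∀ b, π (s b) = b := fun b => Function.surjInv_eq hπ _
  let e : L' → V := fun b => ((ρ' (s b))⁻¹ : F) • τ (s b) v
  have he : ∀ x : L'.comap π, τ x v = (ρ' x : F) • e ⟨π x, x.2⟩ := fun x => by
    have hz : ((s ⟨π x, x.2⟩ : E)⁻¹ * x : E) ∈ Subgroup.center E := by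
      rw [← hker, MonoidHom.mem_ker, map_mul, map_inv, hs]
      simp
    have hx : x = s ⟨π x, x.2⟩ * ⟨_, hzL' ⟨_, hz⟩⟩ := by ext; simp
    have h1 : τ x v = (ζ ⟨_, hz⟩ : F) • τ (s ⟨π x, x.2⟩) v := by
      conv_lhs => rw [hx]
      rw [Subgroup.coe_mul, map_mul, Module.End.mul_apply, hUζ ⟨_, hz⟩ v hvU, map_smul]
    have h2 : (ρ' x : F) = ρ' (s ⟨π x, x.2⟩) * ζ ⟨_, hz⟩ := by
      conv_lhs => rw [hx]
      rw [map_mul, hρ'z, Units.val_mul]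
    rw [h1, h2]
    simp only [e, smul_smul]
    congr 1
    rw [mul_right_comm, mul_inv_cancel₀ (Units.ne_zero _), one_mul]
  have hlift : ∀ b : L', ∃ x : L'.comap π, b = ⟨π x, x.2⟩ := fun b =>
    ⟨s b, Subtype.ext (hs b).symm⟩
  clear_value e
  have hinj : ∀ x : E, Function.Injective (τ x) := fun x => by
    refine Function.LeftInverse.injective (g := τ x⁻¹) fun u => ?_
    rw [← Module.End.mul_apply, ← map_mul, inv_mul_cancel, map_one, Module.End.one_apply]
  refine ⟨e, ρ, ρ', ?_, ?_, ?_⟩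
  · intro b
    obtain ⟨y, rfl⟩ := hlift b
    intro h0
    have h := he y
    rw [h0, smul_zero] at h
    exact hv0 (hinj y (h.trans (map_zero _).symm))
  · intro x b
    obtain ⟨y, rfl⟩ := hlift b
    refine smul_right_injective V (ρ' y).ne_zero ?_
    simp only
    rw [← map_smul, ← he, ← Module.End.mul_apply, ← map_mul, ← Subgroup.coe_mul, he, map_mul,
      Units.val_mul, smul_smul, mul_comm (ρ' x : F)]
    congr 2
    exact Subtype.ext (by simp)
  · intro a b
    obtain ⟨y, rfl⟩ := hlift b
    refine smul_right_injective V (ρ' y).ne_zero ?_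
    simp only
    have h : (a * y : E) = ⁅(a : E), (y : E)⁆ * (y * a) := by
      rw [commutatorElement_def]; group
    have hyU : τ y v ∈ U := hUE y v hvU
    rw [← map_smul, ← he, ← Module.End.mul_apply, ← map_mul, h, map_mul, map_mul,
      Module.End.mul_apply, Module.End.mul_apply, hρ, map_smul, map_smul,
      hUζ ⟨_, commutatorElement_mem_center hE a y⟩ _ hyU, he, hc, commutatorPairing_apply,
      smul_smul, smul_smul, smul_smul]
    congr 1
    ring

/-- The irreducible representation of an extraspecial group in its Schrödinger form: up to
scalars, the group consists of the Weyl operators of a basis. -/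
theorem IsExtraspecial.exists_weyl_basis {p : ℕ} (hp : p.Prime) (hpF : (p : F) ≠ 0)
    (hE : IsExtraspecial p E) (hτ : Function.Injective τ)
    (hd : Module.finrank F V ^ 2 = Nat.card (E ⧸ Subgroup.center E)) :
    ∃ (I : Type u) (_ : AddCommGroup I) (_ : Fintype I) (e : Module.Basis I F V),
      (∀ i : I, p • i = 0) ∧ (∀ i : I, i ≠ 0 → ∃ χ : AddChar I F, χ i ≠ 1) ∧
      (∀ x : E, ∃ (k : F) (χ : AddChar I F) (b : I), k ≠ 0 ∧ τ x = k • weylOp e χ b) ∧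
      (∀ (χ : AddChar I F) (b : I), ∃ (x : E) (k : F), k ≠ 0 ∧ τ x = k • weylOp e χ b) := by
  obtain ⟨M, _, π, hπ, hker, hMd⟩ : ∃ (M : Type u) (_ : CommGroup M) (π : E →* M),
      Function.Surjective π ∧ π.ker = Subgroup.center E ∧
      Nat.card M = Nat.card (E ⧸ Subgroup.center E) := by
    have hcomm := Subgroup.Normal.quotient_commutative_iff_commutator_le.mpr
      hE.commutator_le_center
    exact ⟨E ⧸ Subgroup.center E,
      { (inferInstance : Group (E ⧸ Subgroup.center E)) with mul_comm := hcomm.is_comm.comm },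
      QuotientGroup.mk' (Subgroup.center E), QuotientGroup.mk'_surjective _,
      QuotientGroup.ker_mk' _, rfl⟩
  have := hE.finite
  have : Finite M := Finite.of_surjective π hπ
  have hMp : ∀ x : M, x ^ p = 1 := fun x => by
    obtain ⟨x, rfl⟩ := hπ x
    rw [← map_pow, ← MonoidHom.mem_ker, hker]
    exact hE.pow_mem_center x
  have : HasEnoughRootsOfUnity F (Monoid.exponent M) := by
    have : NeZero (p : F) := ⟨hpF⟩
    have : NeZero p := ⟨hp.ne_zero⟩
    exact HasEnoughRootsOfUnity.of_dvd F (Monoid.exponent_dvd_of_forall_pow_eq_one hMp)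
  obtain ⟨ζ, hζ, U, hU, hUE, hUζ⟩ := hE.exists_central_character hp hpF hτ
  obtain ⟨c, hcE⟩ := exists_pairing_on_quotient hE.commutator_le_center hζ hπ hker
  have hc1 : ∀ x y : E, c (π x) (π y) = 1 ↔ x * y = y * x := fun x y => by
    rw [hcE, commutatorPairing_eq_one_iff _ hζ]
  have hc : Function.Injective c := by
    rw [injective_iff_map_eq_one]
    intro m hm
    obtain ⟨x, rfl⟩ := hπ m
    rw [← MonoidHom.mem_ker, hker, Subgroup.mem_center_iff]
    exact fun y => ((hc1 x y).mp (by rw [hm]; rfl)).symm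
  have halt : ∀ m, c m m = 1 := fun m => by
    obtain ⟨x, rfl⟩ := hπ m
    exact (hc1 x x).mpr rfl
  obtain ⟨L, L', hL, hL', hinf, hsup⟩ := exists_complementary_lagrangians hp hMp hc halt
  obtain ⟨e, ρ, ρ', he0, he', heL⟩ := exists_weyl_vectors hE.commutator_le_center hζ hπ hker hU
    hUE hUζ hcE hL hL'
  have hinj' := crossPairing_injective hc hL' (sup_comm L L' ▸ hsup)
  have hswap : ∀ (l : L) (b : L'), crossPairing c L' L b⁻¹ l = c l b := fun l b => by
    rw [crossPairing_apply, Subgroup.coe_inv, map_inv, MonoidHom.inv_apply, inv_eq_iff_mul_eq_one]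
    exact pairing_swap halt _ _
  have hliftL : ∀ l : L, ∃ a : L.comap π, ⟨π a, a.2⟩ = l := fun l => by
    obtain ⟨x, hx⟩ := hπ l
    exact ⟨⟨x, by rw [Subgroup.mem_comap, hx]; exact l.2⟩, Subtype.ext hx⟩
  have := Fintype.ofFinite L'
  -- The eigencharacters of `L` on the vectors `e b` are distinct, hence linearly independent.
  have hli : LinearIndependent F e := by
    rw [Fintype.linearIndependent_iff]
    intro g hg b₀
    have hφ : ∀ φ : Module.Dual F V, φ (g b₀ • e b₀) = 0 := fun φ => by
      have hind := (linearIndependent_monoidHom L F).comp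
        (fun b : L' => (Units.coeHom F).comp (crossPairing c L' L b⁻¹))
        (fun b b' h => inv_injective (hinj' (MonoidHom.ext fun l =>
          Units.ext (DFunLike.congr_fun h l))))
      refine (Fintype.linearIndependent_iff.mp hind) (fun b => φ (g b • e b)) ?_ b₀
      ext l
      obtain ⟨a, rfl⟩ := hliftL l
      have h := congrArg (fun v => (ρ a : F)⁻¹ * φ (τ a v)) hg
      simp only [map_sum, map_smul, heL, map_zero, mul_zero, Finset.mul_sum] at h
      rw [Finset.sum_apply, Pi.zero_apply, ← h]
      refine Finset.sum_congr rfl fun b _ => ?_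
      simp only [Pi.smul_apply, Function.comp_apply, MonoidHom.comp_apply, hswap, smul_eq_mul,
        Units.coeHom_apply, map_smul]
      field_simp
    exact (smul_eq_zero.mp ((Module.forall_dual_apply_eq_zero_iff F _).mp hφ)).resolve_right
      (he0 b₀)
  have hcard : Fintype.card L' = Module.finrank F V := by
    have h := card_lagrangian_sq hc hL hL' hinf hsup
    rw [hMd, ← hd] at h
    rw [← Nat.card_eq_fintype_card]
    exact Nat.pow_left_injective two_ne_zero h
  let B : Module.Basis (Additive L') F V :=
    (basisOfLinearIndependentOfCardEqFinrank hli hcard).reindex Additive.ofMul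
  have hB : ∀ b : Additive L', B b = e b.toMul := fun b => by simp [B]
  let X : L → AddChar (Additive L') F := fun l =>
    { toFun := fun b => (c l b.toMul : F)
      map_zero_eq_one' := by simp
      map_add_eq_mul' := fun b b' => by simp }
  have hX : ∀ l b, X l b = (c l b.toMul : F) := fun l b => rfl
  have hop : ∀ (a : L.comap π) (x : L'.comap π), ∃ k : F, k ≠ 0 ∧
      τ (a * x) = k • weylOp B (X ⟨π a, a.2⟩) (Additive.ofMul ⟨π x, x.2⟩) := fun a x => by
    refine ⟨ρ' x * (ρ a * c (π a) (π x)), by simp, B.ext fun b => ?_⟩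
    rw [LinearMap.smul_apply, weylOp_apply, hX, hB, hB, map_mul, Module.End.mul_apply, he',
      map_smul, heL, smul_smul, smul_smul]
    simp only [toMul_add, toMul_ofMul, Subgroup.coe_mul, map_mul, Units.val_mul]
    rw [mul_comm b.toMul]
    congr 1
    ring
  refine ⟨Additive L', inferInstance, inferInstance, B, ?_, ?_, ?_, ?_⟩
  · intro b
    refine Additive.toMul.injective (Subtype.ext ?_)
    simpa using hMp b.toMul
  · intro b hb
    by_contra! h
    have hb1 : crossPairing c L' L b.toMul⁻¹ = 1 := MonoidHom.ext fun l =>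
      Units.ext (by rw [hswap, ← hX, h]; rfl)
    have := (injective_iff_map_eq_one _).mp hinj' _ hb1
    exact hb (by simpa using this)
  · intro x
    obtain ⟨l, hl, b, hb, hlb⟩ := Subgroup.mem_sup.mp (hsup ▸ Subgroup.mem_top (π x))
    obtain ⟨y, rfl⟩ := hπ b
    have hy : x * y⁻¹ ∈ L.comap π := by
      rw [Subgroup.mem_comap, map_mul, map_inv, ← hlb, mul_inv_cancel_right]
      exact hl
    obtain ⟨k, hk, h⟩ := hop ⟨_, hy⟩ ⟨y, hb⟩
    exact ⟨k, _, _, hk, by simpa using h⟩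
  · intro χ b
    let ψ : L' →* F :=
      { toFun := fun b => χ (Additive.ofMul b)
        map_one' := χ.map_zero_eq_one
        map_mul' := fun b b' => χ.map_add_eq_mul _ _ }
    obtain ⟨l, hl⟩ := crossPairing_surjective hc hL hL' hsup ψ.toHomUnits
    obtain ⟨a, rfl⟩ := hliftL l
    obtain ⟨y, hy⟩ := hπ b.toMul
    obtain ⟨k, hk, h⟩ := hop a ⟨y, by rw [Subgroup.mem_comap, hy]; exact b.toMul.2⟩
    refine ⟨a * y, k, hk, h.trans ?_⟩
    congr 2
    · ext b
      rw [hX, ← crossPairing_apply, hl]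
      rfl
    · exact congrArg Additive.ofMul (Subtype.ext hy)

end Existence

/-! ### Operators inverting the Weyl operators -/

section AntiWeyl

variable {F V I : Type*} [Field F] [AddCommGroup V] [Module F V] [AddCommGroup I]

/-- The reflected Weyl operator `e i ↦ χ i • e (b - i)`. Conjugation by it inverts every Weyl
operator up to a scalar. -/
noncomputable def antiWeylOp (e : Module.Basis I F V) (χ : AddChar I F) (b : I) :
    Module.End F V :=
  e.constr F fun i => χ i • e (b - i)

@[simp]
theorem antiWeylOp_apply (e : Module.Basis I F V) (χ : AddChar I F) (b i : I) :
    antiWeylOp e χ b (e i) = χ i • e (b - i) := by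
  simp [antiWeylOp]

/-- The operators `f` with `w f w ∈ F f` for all Weyl operators `w`; if `f` is invertible,
conjugation by `f` inverts the Weyl operators up to scalars. -/
def InvertsWeyl (e : Module.Basis I F V) (f : Module.End F V) : Prop :=
  ∀ χ b, ∃ k : F, weylOp e χ b * f * weylOp e χ b = k • f

/-- Conjugation by `g⁻¹` carries each Weyl operator to a multiple of a Weyl operator. -/
def NormalizesWeyl (e : Module.Basis I F V) (g : (Module.End F V)ˣ) : Prop :=
  ∀ χ b, ∃ (k : F) (χ' : AddChar I F) (b' : I),
    (↑g⁻¹ : Module.End F V) * weylOp e χ b * g = k • weylOp e χ' b'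

variable {e : Module.Basis I F V}

/-- The normalizer of the Weyl operators acts by conjugation on the operators inverting them. -/
theorem InvertsWeyl.conj {f : Module.End F V} (hf : InvertsWeyl e f) {g : (Module.End F V)ˣ}
    (hg : NormalizesWeyl e g) : InvertsWeyl e (g * f * ↑g⁻¹) := by
  intro χ b
  obtain ⟨k, χ', b', h⟩ := hg χ b
  obtain ⟨m, hm⟩ := hf χ' b'
  have hW : weylOp e χ b = g * (k • weylOp e χ' b') * ↑g⁻¹ := by
    rw [← h]
    simp [mul_assoc]
  refine ⟨k * k * m, ?_⟩
  calc weylOp e χ b * (g * f * ↑g⁻¹) * weylOp e χ b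
      = g * ((k • weylOp e χ' b') * f * (k • weylOp e χ' b')) * ↑g⁻¹ := by
        rw [hW]; simp [mul_assoc]
    _ = (k * k * m) • (g * f * ↑g⁻¹) := by
        simp only [smul_mul_assoc, mul_smul_comm, hm, smul_smul, mul_assoc]

theorem invertsWeyl_smul_antiWeylOp (κ : F) (χ : AddChar I F) (b : I) :
    InvertsWeyl e (κ • antiWeylOp e χ b) := by
  intro χ' b'
  refine ⟨χ' (b - b') * χ b', e.ext fun i => ?_⟩
  simp only [Module.End.mul_apply, LinearMap.smul_apply, weylOp_apply, antiWeylOp_apply, map_smul,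
    smul_smul]
  rw [show b - (i + b') + b' = b - i by abel,
    show χ' (b - b') = χ' i * χ' (b - (i + b')) by
      rw [← AddChar.map_add_eq_mul]; congr 1; abel,
    AddChar.map_add_eq_mul χ i b']
  congr 1
  ring

/-- The reflected Weyl operators are, up to scalars, the only operators inverting all Weyl
operators. -/
theorem InvertsWeyl.exists_eq_smul (hsep : ∀ i : I, i ≠ 0 → ∃ χ : AddChar I F, χ i ≠ 1)
    {f : Module.End F V} (hf : InvertsWeyl e f) (hf0 : f ≠ 0) :
    ∃ (κ : F) (χ : AddChar I F) (b : I), f = κ • antiWeylOp e χ b := by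
  obtain ⟨i₀, hi₀⟩ : ∃ i, f (e i) ≠ 0 := by
    by_contra! h
    exact hf0 (e.ext h)
  obtain ⟨j₀, hj₀⟩ : ∃ j, e.repr (f (e i₀)) j ≠ 0 := by
    by_contra! h
    exact hi₀ (e.repr.map_eq_zero_iff.mp (Finsupp.ext h))
  -- Commutation with the diagonal Weyl operators confines the matrix of `f` to one antidiagonal.
  have hsupp : ∀ i j, e.repr (f (e i)) j ≠ 0 → i + j = i₀ + j₀ := fun i j hij => by
    by_contra hne
    obtain ⟨χ, hχ⟩ := hsep (i + j - (i₀ + j₀)) (sub_ne_zero.mpr hne)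
    obtain ⟨k, hk⟩ := hf χ 0
    have key : ∀ i j, e.repr (f (e i)) j ≠ 0 → χ (i + j) = k := fun i j h => by
      have h1 := congrArg (fun g : Module.End F V => e.repr (g (e i)) j) hk
      simp only [Module.End.mul_apply, weylOp_apply, add_zero, map_smul, repr_weylOp_zero,
        LinearMap.smul_apply, Finsupp.smul_apply, smul_eq_mul] at h1
      refine mul_right_cancel₀ h ?_
      rw [← h1, AddChar.map_add_eq_mul, mul_assoc]
    refine hχ ?_
    rw [AddChar.map_sub_eq_div, key i j hij, key i₀ j₀ hj₀, div_self]
    rw [← key i j hij]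
    exact (AddChar.val_isUnit χ _).ne_zero
  let φ : I → F := fun i => e.repr (f (e i)) (i₀ + j₀ - i)
  have hfe : ∀ i, f (e i) = φ i • e (i₀ + j₀ - i) := fun i => by
    refine e.repr.injective (Finsupp.ext fun j => ?_)
    rw [map_smul, Module.Basis.repr_self, Finsupp.smul_apply]
    rcases eq_or_ne (i₀ + j₀ - i) j with rfl | h
    · simp [φ]
    · rw [Finsupp.single_eq_of_ne' h, smul_zero]
      by_contra h'
      exact h (by rw [← hsupp i j h']; abel)
  have hφt : ∀ t, ∃ k, ∀ i, φ (i + t) = k * φ i := fun t => by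
    obtain ⟨k, hk⟩ := hf 1 t
    refine ⟨k, fun i => ?_⟩
    have h1 := congrArg (fun g : Module.End F V => g (e i)) hk
    simp only [Module.End.mul_apply, weylOp_apply, AddChar.one_apply, one_smul, hfe, map_smul,
      LinearMap.smul_apply, smul_smul] at h1
    rw [show i₀ + j₀ - (i + t) + t = i₀ + j₀ - i by abel] at h1
    exact smul_left_injective F (e.ne_zero _) h1
  have hφ0 : φ 0 ≠ 0 := fun h0 => by
    obtain ⟨k, hk⟩ := hφt i₀
    have : φ i₀ = 0 := by simpa [h0] using hk 0
    exact hi₀ (by rw [hfe, this, zero_smul])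
  let χ : AddChar I F :=
    { toFun := fun i => φ i / φ 0
      map_zero_eq_one' := div_self hφ0
      map_add_eq_mul' := fun s t => by
        obtain ⟨k, hk⟩ := hφt t
        have h0 : φ t = k * φ 0 := by simpa using hk 0
        rw [hk, h0]
        field_simp }
  refine ⟨φ 0, χ, i₀ + j₀, e.ext fun i => ?_⟩
  rw [hfe, LinearMap.smul_apply, antiWeylOp_apply, smul_smul]
  congr 1
  change φ i = φ 0 * (φ i / φ 0)
  field_simp

theorem antiWeylOp_mul_self (χ : AddChar I F) (b : I) :
    antiWeylOp e χ b * antiWeylOp e χ b = χ b • 1 := by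
  refine e.ext fun i => ?_
  simp only [Module.End.mul_apply, antiWeylOp_apply, map_smul, smul_smul, sub_sub_cancel,
    LinearMap.smul_apply, Module.End.one_apply, ← AddChar.map_add_eq_mul, add_sub_cancel]

theorem trace_antiWeylOp [Fintype I] (h2 : Function.Injective fun i : I => i + i)
    (χ : AddChar I F) (h : I) : LinearMap.trace F V (antiWeylOp e χ (h + h)) = χ h := by
  classical
  rw [LinearMap.trace_eq_matrix_trace F e, Matrix.trace, Finset.sum_eq_single h]
  · simp [LinearMap.toMatrix_apply]
  · intro i _ hi
    have : h + h - i ≠ i := fun h' => hi (h2 ((sub_eq_iff_eq_add.mp h').symm))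
    simp [LinearMap.toMatrix_apply, Finsupp.single_eq_of_ne this.symm]
  · simp

end AntiWeyl

/-! ### Families permuted by the normalizer -/

section Families

variable {F V I : Type*} [Field F] [AddCommGroup V] [Module F V] [AddCommGroup I]

theorem List.prod_map_smul_smul {A X : Type*} [Ring A] [Algebra F A] (l : List X) (φ : X → F)
    (x : X → A) : (l.map fun i => φ i • x i).prod = (l.map φ).prod • (l.map x).prod := by
  induction l with
  | nil => simp
  | cons a l ih => simp [ih, smul_smul, mul_comm]

theorem AddChar.prod_map_eq (χ : AddChar I F) (l : List I) : (l.map χ).prod = χ l.sum := by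
  induction l with
  | nil => simp
  | cons a l ih => simp [ih, AddChar.map_add_eq_mul]

theorem AddChar.apply_ne_zero (χ : AddChar I F) (i : I) : χ i ≠ 0 :=
  (AddChar.val_isUnit χ i).ne_zero

/-- If the indices in `Q` sum to zero, the character values multiply to one, so that a reflected
Weyl operator acts on the monomial with indices `Q` by reflection of the indices, up to a scalar
that does not depend on `Q` beyond its length. -/
theorem prod_map_smul_antiWeylOp {A : Type*} [Ring A] [Algebra F A] (l : V →ₗ[F] A)
    (e : Module.Basis I F V) (κ : F) (χ : AddChar I F) (b : I) (Q : List I) (hQ : Q.sum = 0) :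
    (Q.map fun q => l ((κ • antiWeylOp e χ b) (e q))).prod =
      κ ^ Q.length • (Q.map fun q => l (e (b - q))).prod := by
  simp only [LinearMap.smul_apply, antiWeylOp_apply, map_smul, smul_smul]
  rw [List.prod_map_smul_smul, List.prod_map_mul, AddChar.prod_map_eq, hQ]
  simp

theorem sum_addChar_eq_zero [Fintype (AddChar I F)] {i : I} (h : ∃ χ : AddChar I F, χ i ≠ 1) :
    ∑ χ : AddChar I F, χ i = 0 := by
  obtain ⟨ψ, hψ⟩ := h
  have h1 : ψ i * ∑ χ : AddChar I F, χ i = ∑ χ : AddChar I F, χ i := by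
    rw [Finset.mul_sum]
    exact Fintype.sum_equiv (Equiv.mulLeft ψ) _ _ fun χ => by simp
  exact (mul_left_eq_self₀.mp h1).resolve_left hψ

variable (F I) in
theorem finite_addChar [Finite I] : Finite (AddChar I F) := by
  have : Finite (Multiplicative I →* F) := (linearIndependent_monoidHom (Multiplicative I) F).finite
  exact Finite.of_equiv _ AddChar.toMonoidHomEquiv.symm

theorem natCast_card_addChar_ne_zero {p : ℕ} (hp : p.Prime) (hpF : (p : F) ≠ 0)
    [Finite (AddChar I F)] (hI : ∀ i : I, p • i = 0) : (Nat.card (AddChar I F) : F) ≠ 0 := by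
  have : Fact p.Prime := ⟨hp⟩
  have hP : IsPGroup p (AddChar I F) := fun χ => ⟨1, by
    ext i
    rw [pow_one, AddChar.pow_apply, ← AddChar.map_nsmul_eq_pow, hI, AddChar.map_zero_eq_one]
    rfl⟩
  obtain ⟨n, hn⟩ := IsPGroup.iff_card.mp hP
  rw [hn, Nat.cast_pow]
  exact pow_ne_zero _ hpF

/-- The reflected Weyl operators normalized to have trace one, for odd `p`: the point reflections
`e i ↦ χ (i - h) • e (2h - i)` of the phase space. -/
noncomputable def pointReflection (e : Module.Basis I F V) (j : AddChar I F × I) :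
    Module.End F V :=
  j.1 (-j.2) • antiWeylOp e j.1 (j.2 + j.2)

theorem pointReflection_injective (h2 : Function.Injective fun i : I => i + i)
    (e : Module.Basis I F V) : Function.Injective (pointReflection e) := by
  rintro ⟨χ, h⟩ ⟨χ', h'⟩ heq
  have hap : ∀ i, (χ (-h) * χ i) • e (h + h - i) = (χ' (-h') * χ' i) • e (h' + h' - i) := fun i =>
    by simpa [pointReflection, smul_smul] using congrArg (fun f : Module.End F V => f (e i)) heq
  have hh : h = h' := by
    have h0 := congrArg (fun v => e.repr v (h + h)) (hap 0)
    by_contra hne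
    have : h' + h' ≠ h + h := fun h0 => hne (h2 h0).symm
    simp [Finsupp.single_eq_of_ne' this, AddChar.apply_ne_zero] at h0
  subst hh
  have hχ : ∀ i, χ (-h) * χ i = χ' (-h) * χ' i := fun i =>
    smul_left_injective F (e.ne_zero _) (hap i)
  simp only [Prod.mk.injEq, and_true]
  ext i
  have h1 : χ (-h) = χ' (-h) := by simpa using hχ 0
  exact mul_left_cancel₀ (χ.apply_ne_zero (-h)) ((hχ i).trans (by rw [h1]))

/-- The trace determines the scalar, so the normalizer permutes the point reflections exactly and
not only up to scalars. -/
theorem exists_conj_pointReflection [Fintype I] {p : ℕ} (hp2 : Odd p)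
    (hI : ∀ i : I, p • i = 0) (hsep : ∀ i : I, i ≠ 0 → ∃ χ : AddChar I F, χ i ≠ 1)
    (h2 : Function.Injective fun i : I => i + i)
    {e : Module.Basis I F V} {g : (Module.End F V)ˣ} (hg : NormalizesWeyl e g)
    (j : AddChar I F × I) :
    ∃ j', g * pointReflection e j * ↑g⁻¹ = pointReflection e j' := by
  have htr : ∀ j, LinearMap.trace F V (pointReflection e j) = 1 := fun j => by
    rw [pointReflection, map_smul, trace_antiWeylOp h2, smul_eq_mul, ← AddChar.map_add_eq_mul,
      neg_add_cancel, AddChar.map_zero_eq_one]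
  have htr' : LinearMap.trace F V (g * pointReflection e j * ↑g⁻¹) = 1 := by
    rw [LinearMap.trace_mul_comm, ← mul_assoc, Units.inv_mul, one_mul, htr]
  obtain ⟨κ, χ, b, h⟩ := ((invertsWeyl_smul_antiWeylOp (e := e) (j.1 (-j.2)) j.1
    (j.2 + j.2)).conj hg).exists_eq_smul hsep (fun h0 => by
      rw [pointReflection, h0, map_zero] at htr'
      exact zero_ne_one htr')
  obtain ⟨m, hm⟩ := hp2
  have hb : b = (m + 1) • b + (m + 1) • b := by
    have := hI b
    rw [hm] at this
    calc b = (2 * m + 1) • b + b := by rw [this, zero_add]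
      _ = _ := by module
  refine ⟨(χ, (m + 1) • b), ?_⟩
  rw [pointReflection] at htr' ⊢
  rw [h, hb, map_smul, trace_antiWeylOp h2] at htr'
  rw [h, pointReflection, ← hb]
  congr 1
  rw [AddChar.map_neg_eq_inv]
  exact eq_inv_of_mul_eq_one_left htr'

/-- Summing over the characters leaves the reflections `h` killed by the length of `Q`. For length
`3` these are all `h` if `p = 3`, and only `h = 0` if `p ≥ 5`. -/
theorem sum_prod_pointReflection [Fintype I] [Fintype (AddChar I F)] [DecidableEq I]
    (hsep : ∀ i : I, i ≠ 0 → ∃ χ : AddChar I F, χ i ≠ 1)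
    {A : Type*} [Ring A] [Algebra F A] (l : V →ₗ[F] A) (e : Module.Basis I F V)
    (Q : List I) (hQ : Q.sum = 0) :
    ∑ j, (Q.map fun q => l (pointReflection e j (e q))).prod =
      (Fintype.card (AddChar I F) : F) • ∑ h with Q.length • h = 0,
        (Q.map fun q => l (e (h + h - q))).prod := by
  simp only [pointReflection, prod_map_smul_antiWeylOp l e _ _ _ Q hQ]
  rw [Fintype.sum_prod_type_right, Finset.sum_filter, Finset.smul_sum]
  refine Finset.sum_congr rfl fun h _ => ?_
  simp only [← Finset.sum_smul, ← AddChar.map_nsmul_eq_pow]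
  split_ifs with h0
  · simp [h0]
  · rw [sum_addChar_eq_zero (hsep _ (by simpa using h0)), zero_smul, smul_zero]

theorem intUnits_cast_sq (u : ℤˣ) : (((u : ℤ) : F)) ^ 2 = 1 := by
  rcases Int.units_eq_one_or u with rfl | rfl <;> simp

theorem intUnits_cast_ne_zero (u : ℤˣ) : (((u : ℤ) : F)) ≠ 0 := fun h => by
  simpa [h] using intUnits_cast_sq (F := F) u

variable [IsAlgClosed F]

/-- A square root of `(χ b)⁻¹`, which makes `antiWeylOp e χ b` an involution. -/
noncomputable def weylSign (χ : AddChar I F) (b : I) : F :=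
  (IsAlgClosed.exists_pow_nat_eq (χ b)⁻¹ two_pos).choose

theorem weylSign_sq (χ : AddChar I F) (b : I) : weylSign χ b ^ 2 = (χ b)⁻¹ :=
  (IsAlgClosed.exists_pow_nat_eq (χ b)⁻¹ two_pos).choose_spec

theorem weylSign_ne_zero (χ : AddChar I F) (b : I) : weylSign χ b ≠ 0 := fun h => by
  have := weylSign_sq χ b
  rw [h] at this
  exact χ.apply_ne_zero b (by simpa using this.symm)

/-- The reflected Weyl operators normalized to be involutions. For `p = 2` these are, up to
scalars, the Weyl operators themselves. -/
noncomputable def involutiveWeylOp (e : Module.Basis I F V) (j : AddChar I F × I × ℤˣ) :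
    Module.End F V :=
  (((j.2.2 : ℤ) : F) * weylSign j.1 j.2.1) • antiWeylOp e j.1 j.2.1

theorem involutiveWeylOp_sq (e : Module.Basis I F V) (j : AddChar I F × I × ℤˣ) :
    involutiveWeylOp e j ^ 2 = 1 := by
  rw [involutiveWeylOp, smul_pow, mul_pow, intUnits_cast_sq, weylSign_sq, one_mul, sq,
    antiWeylOp_mul_self, smul_smul, inv_mul_cancel₀ (AddChar.apply_ne_zero _ _), one_smul]

theorem involutiveWeylOp_injective (h2 : (2 : F) ≠ 0) (e : Module.Basis I F V) :
    Function.Injective (involutiveWeylOp e) := by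
  rintro ⟨χ, b, u⟩ ⟨χ', b', u'⟩ heq
  have hap : ∀ i, ((u : ℤ) * weylSign χ b * χ i : F) • e (b - i) =
      ((u' : ℤ) * weylSign χ' b' * χ' i : F) • e (b' - i) := fun i => by
    simpa [involutiveWeylOp, smul_smul, mul_assoc] using
      congrArg (fun f : Module.End F V => f (e i)) heq
  have hb : b = b' := by
    have h0 := congrArg (fun v => e.repr v b) (hap 0)
    by_contra hne
    simp [Finsupp.single_eq_of_ne hne, intUnits_cast_ne_zero, weylSign_ne_zero] at h0
  subst hb
  have hχ' : ∀ i, ((u : ℤ) * weylSign χ b * χ i : F) = (u' : ℤ) * weylSign χ' b * χ' i :=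
    fun i => smul_left_injective F (e.ne_zero _) (hap i)
  have h0 : ((u : ℤ) * weylSign χ b : F) = (u' : ℤ) * weylSign χ' b := by simpa using hχ' 0
  have hχ : χ = χ' := by
    ext i
    exact mul_left_cancel₀ (mul_ne_zero (intUnits_cast_ne_zero u) (weylSign_ne_zero χ b))
      ((hχ' i).trans (by rw [h0]))
  subst hχ
  have hu := mul_right_cancel₀ (weylSign_ne_zero χ b) h0
  have : u = u' := by
    have h11 : (1 : F) ≠ -1 := fun h => h2 (by linear_combination h)
    rcases Int.units_eq_one_or u with rfl | rfl <;>
      rcases Int.units_eq_one_or u' with rfl | rfl <;> simp_all [h11.symm]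
  rw [this]

/-- Being an involution determines the scalar up to sign, and the family contains both signs, so
the normalizer permutes it. -/
theorem exists_conj_involutiveWeylOp (hsep : ∀ i : I, i ≠ 0 → ∃ χ : AddChar I F, χ i ≠ 1)
    {e : Module.Basis I F V} {g : (Module.End F V)ˣ} (hg : NormalizesWeyl e g)
    (j : AddChar I F × I × ℤˣ) :
    ∃ j', g * involutiveWeylOp e j * ↑g⁻¹ = involutiveWeylOp e j' := by
  have : Nontrivial V := ⟨e 0, 0, e.ne_zero 0⟩
  have hsq : (g * involutiveWeylOp e j * ↑g⁻¹) ^ 2 = 1 := by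
    rw [Units.conj_pow, involutiveWeylOp_sq, mul_one, Units.mul_inv]
  obtain ⟨κ, χ, b, h⟩ := ((invertsWeyl_smul_antiWeylOp (e := e) _ j.1 j.2.1).conj
    hg).exists_eq_smul hsep (fun h0 => by
      rw [involutiveWeylOp, h0] at hsq
      simp at hsq)
  rw [involutiveWeylOp, h] at hsq ⊢
  rw [smul_pow, sq (antiWeylOp e χ b), antiWeylOp_mul_self, smul_smul] at hsq
  have hκ : κ ^ 2 * χ b = 1 := by
    have := congrArg (fun f : Module.End F V => f (e 0)) hsq
    exact smul_left_injective F (e.ne_zero 0) (by simpa using this)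
  have hκ' : κ ^ 2 = weylSign χ b ^ 2 := by
    rw [weylSign_sq]
    exact eq_inv_of_mul_eq_one_left hκ
  rcases sq_eq_sq_iff_eq_or_eq_neg.mp hκ' with rfl | rfl
  · exact ⟨(χ, b, 1), by simp [involutiveWeylOp]⟩
  · exact ⟨(χ, b, -1), by simp [involutiveWeylOp]⟩

/-- The fourth power of the normalizing scalar is `1`, so with four factors nothing cancels in the
sum over the characters and the signs. -/
theorem sum_prod_involutiveWeylOp [Fintype I] [Fintype (AddChar I F)]
    (hI : ∀ i : I, i + i = 0)
    {A : Type*} [Ring A] [Algebra F A] (l : V →ₗ[F] A) (e : Module.Basis I F V)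
    (Q : List I) (hQ : Q.sum = 0) (hQ4 : Q.length = 4) :
    ∑ j, (Q.map fun q => l (involutiveWeylOp e j (e q))).prod =
      (2 * Fintype.card (AddChar I F) : F) • ∑ h, (Q.map fun q => l (e (h - q))).prod := by
  have h4 : ∀ j : AddChar I F × I × ℤˣ, (((j.2.2 : ℤ) : F) * weylSign j.1 j.2.1) ^ 4 = 1 := by
    intro j
    have hb : (j.1 j.2.1) ^ 2 = 1 := by
      rw [← AddChar.map_nsmul_eq_pow, two_nsmul, hI, AddChar.map_zero_eq_one]
    rw [show 4 = 2 * 2 from rfl, pow_mul, mul_pow, intUnits_cast_sq, weylSign_sq, one_mul,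
      inv_pow, hb, inv_one]
  simp only [involutiveWeylOp, prod_map_smul_antiWeylOp l e _ _ _ Q hQ, hQ4, h4, one_smul]
  simp only [Fintype.sum_prod_type, Finset.sum_const, Finset.card_univ, Fintype.card_units_int,
    ← Finset.smul_sum, ← Nat.cast_smul_eq_nsmul F, smul_smul]
  push_cast
  rw [mul_comm]

end Families

/-! ### A reducibility criterion for functorial algebras -/

section PowerFunctor

variable (F V A : Type*) [Field F] [AddCommGroup V] [Module F V] [Ring A] [Algebra F A]

/-- A functorial algebra on `V`, abstracting what the symmetric and the exterior algebra have in
common: a linear map `ι : V → A` and an action of the endomorphisms of `V` by algebra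
endomorphisms extending the action on `V`. -/
structure FunctorialAlgebra where
  /-- The structure map from the vector space to the algebra. -/
  ι : V →ₗ[F] A
  /-- The algebra endomorphism induced by a linear endomorphism. -/
  map : Module.End F V → A →ₐ[F] A
  map_ι : ∀ f v, map f (ι v) = ι (f v)
  map_mul : ∀ f g, map (f * g) = (map f).comp (map g)

variable {F V A} (Φ : FunctorialAlgebra F V A)

namespace FunctorialAlgebra

theorem map_prod (f : Module.End F V) (l : List V) :
    Φ.map f (l.map Φ.ι).prod = (l.map fun v => Φ.ι (f v)).prod := by
  rw [map_list_prod, List.map_map]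
  congr 2
  ext v
  exact Φ.map_ι f v

theorem prod_mem (l : List V) : (l.map Φ.ι).prod ∈ LinearMap.range Φ.ι ^ l.length := by
  induction l with
  | nil => simpa using (Submodule.mem_one.mpr ⟨1, map_one _⟩ : (1 : A) ∈ (1 : Submodule F A))
  | cons v l ih =>
    rw [List.map_cons, List.prod_cons, List.length_cons, pow_succ']
    exact Submodule.mul_mem_mul ⟨v, rfl⟩ ih

theorem map_mem (f : Module.End F V) {k : ℕ} {x : A} (hx : x ∈ LinearMap.range Φ.ι ^ k) :
    Φ.map f x ∈ LinearMap.range Φ.ι ^ k := by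
  have h : (LinearMap.range Φ.ι ^ k).map (Φ.map f).toLinearMap ≤ LinearMap.range Φ.ι ^ k := by
    rw [Submodule.map_pow]
    refine pow_le_pow_left' ?_ k
    rintro _ ⟨_, ⟨v, rfl⟩, rfl⟩
    exact ⟨f v, (Φ.map_ι f v).symm⟩
  exact h ⟨x, hx, rfl⟩

theorem exists_polynomial_eval {X : Type*} (l : List X) (f g : X → A) (φ : A →ₗ[F] F) :
    ∃ P : Polynomial F, ∀ s : F, φ (l.map fun x => f x + s • g x).prod = P.eval s := by
  induction l generalizing φ with
  | nil => exact ⟨Polynomial.C (φ 1), by simp⟩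
  | cons x l ih =>
    obtain ⟨P₁, h₁⟩ := ih (φ ∘ₗ LinearMap.mulLeft F (f x))
    obtain ⟨P₂, h₂⟩ := ih (φ ∘ₗ LinearMap.mulLeft F (g x))
    refine ⟨P₁ + Polynomial.X * P₂, fun s => ?_⟩
    simp [add_mul, ← h₁, ← h₂]

variable {J : Type*} [Fintype J]

/-- The operator `∑ⱼ Φ(1 + s Bⱼ)` is not scalar for a suitable `s`, if the part of it that moves
exactly the factors in `Q` contributes. The map `π` kills the factors in `Q`, hence everything
except the terms moving all of them. -/
theorem exists_sum_map_ne_smul [Infinite F] (B : J → Module.End F V) (Q R : List V)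
    (π : Module.End F V) (hQ : ∀ q ∈ Q, π q = 0) (hQ0 : Q ≠ []) (hR : ∀ r ∈ R, π r = r)
    (h : (∑ j, (Q.map fun q => Φ.ι (π (B j q))).prod) * (R.map Φ.ι).prod ≠ 0) :
    ∃ s : F, ∀ μ : F, ∑ j, Φ.map (1 + s • B j) ((Q ++ R).map Φ.ι).prod ≠
      μ • ((Q ++ R).map Φ.ι).prod := by
  by_contra! hs
  have hkill : Φ.map π ((Q ++ R).map Φ.ι).prod = 0 := by
    rw [map_prod]
    obtain ⟨q, hq⟩ := List.exists_mem_of_ne_nil Q hQ0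
    exact List.prod_eq_zero (List.mem_map.mpr ⟨q, by simp [hq], by rw [hQ q hq, map_zero]⟩)
  -- `Φ π` maps the image of the monomial to `s ^ |Q| • S s`, with `S` polynomial in `s` and `S 0`
  -- the element assumed nonzero.
  let S : F → A := fun s => ∑ j, (Q.map fun q => Φ.ι (π (B j q))).prod *
    (R.map fun r => Φ.ι r + s • Φ.ι (π (B j r))).prod
  have hS : ∀ s, s ≠ 0 → S s = 0 := fun s hs0 => by
    obtain ⟨μ, hμ⟩ := hs s
    have h1 := congrArg (Φ.map π) hμ
    rw [map_smul, hkill, smul_zero, map_sum] at h1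
    have h2 : ∀ j, Φ.map π (Φ.map (1 + s • B j) ((Q ++ R).map Φ.ι).prod) =
        s ^ Q.length • ((Q.map fun q => Φ.ι (π (B j q))).prod *
          (R.map fun r => Φ.ι r + s • Φ.ι (π (B j r))).prod) := fun j => by
      rw [← AlgHom.comp_apply, ← Φ.map_mul, map_prod, List.map_append, List.prod_append,
        ← smul_mul_assoc]
      congr 1
      · rw [← List.prod_replicate, ← List.map_const', ← List.prod_map_smul_smul]
        congr 1
        refine List.map_congr_left fun q hq => ?_
        simp [hQ q hq]
      · congr 1
        refine List.map_congr_left fun r hr => ?_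
        simp [hR r hr]
    simp only [h2, ← Finset.smul_sum] at h1
    exact (smul_eq_zero.mp h1).resolve_left (pow_ne_zero _ hs0)
  have hS0 : S 0 ≠ 0 := by
    simpa [S, Finset.sum_mul] using h
  obtain ⟨φ, hφ⟩ := Module.Projective.exists_dual_ne_zero F hS0
  choose P hP using fun j => exists_polynomial_eval R Φ.ι (fun r => Φ.ι (π (B j r)))
    (φ ∘ₗ LinearMap.mulLeft F (Q.map fun q => Φ.ι (π (B j q))).prod)
  have hSP : ∀ s, φ (S s) = (∑ j, P j).eval s := fun s => by
    rw [Polynomial.eval_finsetSum, map_sum]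
    exact Finset.sum_congr rfl fun j _ => hP j s
  have hzero : ∑ j, P j = 0 := by
    refine Polynomial.eq_zero_of_infinite_isRoot _
      ((Set.finite_singleton (0 : F)).infinite_compl.mono ?_)
    intro s hs
    rw [Set.mem_ofPred_eq, Polynomial.IsRoot, ← hSP, hS s hs, map_zero]
  exact hφ (by rw [hSP, hzero, Polynomial.eval_zero])

/-- A finite family of endomorphisms permuted by `G` yields operators commuting with `G`; if one
of them is not scalar, its eigenspaces are proper invariant subspaces. -/
theorem reducibleOver_of_family [IsAlgClosed F] {k : ℕ}
    [FiniteDimensional F ↥(LinearMap.range Φ.ι ^ k)]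
    (ρ : Representation F (LinearMap.GeneralLinearGroup F V) ↥(LinearMap.range Φ.ι ^ k))
    (hρ : ∀ g w, (ρ g w : A) = Φ.map (g : V →ₗ[F] V) w)
    {G : Subgroup (LinearMap.GeneralLinearGroup F V)} {B : J → Module.End F V}
    (hB : Function.Injective B)
    (hG : ∀ g ∈ G, ∀ j, ∃ j', (g : Module.End F V) * B j * ↑g⁻¹ = B j')
    (Q R : List V) (hk : Q.length + R.length = k)
    (π : Module.End F V) (hQ : ∀ q ∈ Q, π q = 0) (hQ0 : Q ≠ []) (hR : ∀ r ∈ R, π r = r)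
    (h : (∑ j, (Q.map fun q => Φ.ι (π (B j q))).prod) * (R.map Φ.ι).prod ≠ 0) :
    ReducibleOver ρ G := by
  obtain ⟨s, hs⟩ := Φ.exists_sum_map_ne_smul B Q R π hQ hQ0 hR h
  have hT : ∀ w ∈ LinearMap.range Φ.ι ^ k,
      (∑ j, (Φ.map (1 + s • B j)).toLinearMap) w ∈ LinearMap.range Φ.ι ^ k := fun w hw => by
    rw [LinearMap.sum_apply]
    exact Submodule.sum_mem _ fun j _ => Φ.map_mem _ hw
  let T := (∑ j, (Φ.map (1 + s • B j)).toLinearMap).restrict hT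
  have hTc : ∀ w, (T w : A) = ∑ j, Φ.map (1 + s • B j) w := fun w => by
    simp [T, LinearMap.restrict_apply]
  let w : ↥(LinearMap.range Φ.ι ^ k) :=
    ⟨((Q ++ R).map Φ.ι).prod, by rw [← hk, ← List.length_append]; exact Φ.prod_mem _⟩
  have hw : ∀ μ : F, T w ≠ μ • w := fun μ hμ => hs μ (by
    have := congrArg Subtype.val hμ
    rwa [hTc] at this)
  have : Nontrivial ↥(LinearMap.range Φ.ι ^ k) :=
    ⟨w, 0, fun h0 => hw 0 (by rw [h0, map_zero, smul_zero])⟩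
  obtain ⟨μ, hμ⟩ := Module.End.exists_eigenvalue T
  refine ⟨Module.End.eigenspace T μ, hμ, fun htop => hw μ ?_, fun g hg u hu => ?_⟩
  · exact Module.End.mem_eigenspace_iff.mp (htop ▸ Submodule.mem_top)
  · rw [Module.End.mem_eigenspace_iff] at hu ⊢
    rw [← map_smul, ← hu]
    refine Subtype.ext ?_
    rw [hTc, hρ, hρ, hTc, map_sum]
    choose σ hσ using hG g hg
    have hσb : Function.Bijective σ := by
      refine Finite.injective_iff_bijective.mp fun j j' hj => hB ?_
      have := (hσ j).trans ((congrArg B hj).trans (hσ j').symm)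
      simpa using this
    refine (Fintype.sum_bijective σ hσb _ _ fun j => ?_).symm
    rw [← AlgHom.comp_apply, ← AlgHom.comp_apply, ← Φ.map_mul, ← Φ.map_mul]
    congr 2
    rw [← hσ]
    change (g : Module.End F V) * _ = _ * (g : Module.End F V)
    rw [add_mul, mul_add, mul_one, one_mul, smul_mul_assoc, mul_smul_comm, mul_assoc,
      mul_assoc, Units.inv_mul, mul_one]

end FunctorialAlgebra

/-- The symmetric algebra with its functoriality. -/
noncomputable def symFunctorialAlgebra (F V : Type*) [Field F] [AddCommGroup V] [Module F V] :
    FunctorialAlgebra F V (SymmetricAlgebra F V) where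
  ι := SymmetricAlgebra.ι F V
  map := symAlgMap
  map_ι f v := by simp [symAlgMap]
  map_mul f g := by
    apply SymmetricAlgebra.algHom_ext
    ext v
    simp [symAlgMap]

/-- The exterior algebra with its functoriality. -/
noncomputable def extFunctorialAlgebra (F V : Type*) [Field F] [AddCommGroup V] [Module F V] :
    FunctorialAlgebra F V (ExteriorAlgebra F V) where
  ι := ExteriorAlgebra.ι F
  map := ExteriorAlgebra.map
  map_ι f v := by simp
  map_mul f g := by
    rw [ExteriorAlgebra.map_comp_map]
    rfl

theorem coe_extRep (F V : Type*) [Field F] [AddCommGroup V] [Module F V] (k : ℕ)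
    (g : LinearMap.GeneralLinearGroup F V) (w : ⋀[F]^k V) :
    (extRep F V k g w : ExteriorAlgebra F V) = ExteriorAlgebra.map (g : V →ₗ[F] V) w := by
  have h : (⋀[F]^k V).subtype ∘ₗ exteriorPower.map k (g : V →ₗ[F] V) =
      (ExteriorAlgebra.map (g : V →ₗ[F] V)).toLinearMap ∘ₗ (⋀[F]^k V).subtype := by
    ext v
    simp [ExteriorAlgebra.map_apply_ιMulti]
  exact DFunLike.congr_fun h w

theorem coe_symRep (F V : Type*) [Field F] [AddCommGroup V] [Module F V] (k : ℕ)
    (g : LinearMap.GeneralLinearGroup F V) (w : symPower F V k) :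
    (symRep F V k g w : SymmetricAlgebra F V) = symAlgMap (g : V →ₗ[F] V) w := rfl

end PowerFunctor

/-! ### The criterion in the Schrödinger model -/

theorem eq_zero_of_coprime_nsmul {I : Type*} [AddCommGroup I] {m n : ℕ} (h : m.Coprime n) {i : I}
    (hm : m • i = 0) (hn : n • i = 0) : i = 0 := by
  have h1 := Nat.dvd_gcd (addOrderOf_dvd_of_nsmul_eq_zero hm) (addOrderOf_dvd_of_nsmul_eq_zero hn)
  rw [h] at h1
  exact AddMonoid.addOrderOf_eq_one_iff.mp (Nat.dvd_one.mp h1)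

section CoordinateProjection

variable {F V I : Type*} [Field F] [AddCommGroup V] [Module F V]

open Classical in
/-- The projection onto the span of the basis vectors with index in `K` along the others. -/
noncomputable def coordProj (e : Module.Basis I F V) (K : Set I) : Module.End F V :=
  e.constr F fun i => if i ∈ K then e i else 0

theorem coordProj_of_mem (e : Module.Basis I F V) {K : Set I} {i : I} (hi : i ∈ K) :
    coordProj e K (e i) = e i := by
  simp [coordProj, hi]

theorem coordProj_of_notMem (e : Module.Basis I F V) {K : Set I} {i : I} (hi : i ∉ K) :
    coordProj e K (e i) = 0 := by
  simp [coordProj, hi]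

end CoordinateProjection

section Reduction

variable {F V I A : Type*} [Field F] [IsAlgClosed F] [AddCommGroup V] [Module F V]
  [AddCommGroup I] [Ring A] [Algebra F A] (Φ : FunctorialAlgebra F V A)

/-- The reducibility criterion for monomials in basis vectors and coordinate projections, given the
action of the family on the factors with index in `Q`. -/
theorem FunctorialAlgebra.reducibleOver_of_indexed_family (e : Module.Basis I F V) {k : ℕ}
    [FiniteDimensional F ↥(LinearMap.range Φ.ι ^ k)]
    (ρ : Representation F (LinearMap.GeneralLinearGroup F V) ↥(LinearMap.range Φ.ι ^ k))
    (hρ : ∀ g w, (ρ g w : A) = Φ.map (g : V →ₗ[F] V) w)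
    {G : Subgroup (LinearMap.GeneralLinearGroup F V)} {J : Type*} [Fintype J]
    {B : J → Module.End F V} (hB : Function.Injective B)
    (hG : ∀ g ∈ G, ∀ j, ∃ j', (g : Module.End F V) * B j * ↑g⁻¹ = B j')
    {H : Finset I} (Q R : List I) (hQ0 : Q ≠ []) (hk : Q.length + R.length = k)
    {m : F} (hm : m ≠ 0)
    (hsum : ∀ l : V →ₗ[F] A, ∑ j, (Q.map fun q => l (B j (e q))).prod =
      m • ∑ h ∈ H, (Q.map fun q => l (e (h - q))).prod)
    (K : Set I) (hQK : ∀ q ∈ Q, q ∉ K) (hRK : ∀ i ∈ R, i ∈ K)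
    (hne : (∑ h ∈ H, (Q.map fun q => Φ.ι (coordProj e K (e (h - q)))).prod) *
      (R.map fun i => Φ.ι (e i)).prod ≠ 0) :
    ReducibleOver ρ G := by
  refine Φ.reducibleOver_of_family ρ hρ hB hG (Q.map e) (R.map e) (by simp [hk])
    (coordProj e K) ?_ (by simpa using hQ0) ?_ ?_
  · intro v hv
    obtain ⟨q, hq, rfl⟩ := List.mem_map.mp hv
    exact coordProj_of_notMem e (hQK q hq)
  · intro v hv
    obtain ⟨i, hi, rfl⟩ := List.mem_map.mp hv
    exact coordProj_of_mem e (hRK i hi)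
  · have := hsum (Φ.ι ∘ₗ coordProj e K)
    simp only [LinearMap.comp_apply] at this
    simp only [List.map_map, Function.comp_def, this, smul_mul_assoc]
    exact smul_ne_zero hm hne

variable [Fintype I]

/-- Reducibility of the degree `k` part of a functorial algebra under operators normalizing the
Weyl operators, reduced to the nonvanishing of one explicit element. The list `Q` holds the
indices of the factors that are moved, and their images are the reflections `h - q`, where `h`
is zero for `p ≥ 5` and arbitrary for `p ≤ 3`. -/
theorem FunctorialAlgebra.reducibleOver_of_normalizesWeyl {p : ℕ} (hp : p.Prime)
    (hpF : (p : F) ≠ 0) (hI : ∀ i : I, p • i = 0)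
    (hsep : ∀ i : I, i ≠ 0 → ∃ χ : AddChar I F, χ i ≠ 1) (e : Module.Basis I F V) {k : ℕ}
    [FiniteDimensional F ↥(LinearMap.range Φ.ι ^ k)]
    (ρ : Representation F (LinearMap.GeneralLinearGroup F V) ↥(LinearMap.range Φ.ι ^ k))
    (hρ : ∀ g w, (ρ g w : A) = Φ.map (g : V →ₗ[F] V) w)
    {G : Subgroup (LinearMap.GeneralLinearGroup F V)} (hG : ∀ g ∈ G, NormalizesWeyl e g)
    {r : ℕ} {H : Finset I}
    (hH : 5 ≤ p ∧ r = 3 ∧ H = {0} ∨ p = 3 ∧ r = 3 ∧ H = Finset.univ ∨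
      p = 2 ∧ r = 4 ∧ H = Finset.univ)
    (Q R : List I) (hQr : Q.length = r) (hQs : Q.sum = 0) (hk : r + R.length = k)
    (K : Set I) (hQK : ∀ q ∈ Q, q ∉ K) (hRK : ∀ i ∈ R, i ∈ K)
    (hne : (∑ h ∈ H, (Q.map fun q => Φ.ι (coordProj e K (e (h - q)))).prod) *
      (R.map fun i => Φ.ι (e i)).prod ≠ 0) :
    ReducibleOver ρ G := by
  classical
  have := finite_addChar F I
  have := Fintype.ofFinite (AddChar I F)
  have hN : (Fintype.card (AddChar I F) : F) ≠ 0 := by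
    rw [← Nat.card_eq_fintype_card]
    exact natCast_card_addChar_ne_zero hp hpF hI
  have hQ0 : Q ≠ [] := by
    rintro rfl
    simp at hQr
    omega
  rw [← hQr] at hk
  by_cases hp2 : p = 2
  · obtain ⟨hr, rfl⟩ : r = 4 ∧ H = Finset.univ := by
      rcases hH with h | h | h
      · omega
      · omega
      · exact h.2
    subst hp2
    have h2 : (2 : F) ≠ 0 := by exact_mod_cast hpF
    exact Φ.reducibleOver_of_indexed_family e ρ hρ (involutiveWeylOp_injective h2 e)
      (fun g hg => exists_conj_involutiveWeylOp hsep (hG g hg)) Q R hQ0 hk (mul_ne_zero h2 hN)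
      (fun l => sum_prod_involutiveWeylOp (fun i => by rw [← two_nsmul, hI]) l e Q hQs
        (hQr.trans hr)) K hQK hRK hne
  · have h2 : Function.Injective fun i : I => i + i := fun i j hij => by
      rw [← sub_eq_zero]
      refine eq_zero_of_coprime_nsmul ((Nat.coprime_primes Nat.prime_two hp).mpr (Ne.symm hp2)) ?_
        (hI _)
      rw [nsmul_sub, two_nsmul, two_nsmul, sub_eq_zero]
      exact hij
    have hr : r = 3 := by omega
    refine Φ.reducibleOver_of_indexed_family e ρ hρ (pointReflection_injective h2 e)
      (fun g hg => exists_conj_pointReflection (hp.odd_of_ne_two hp2) hI hsep h2 (hG g hg))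
      Q R hQ0 hk hN (fun l => ?_) K hQK hRK hne
    rw [sum_prod_pointReflection hsep l e Q hQs, hQr, hr]
    congr 1
    rcases hH with ⟨hp5, -, rfl⟩ | ⟨rfl, -, rfl⟩ | h
    · have h3 : ∀ h : I, 3 • h = 0 → h = 0 := fun h h3 => eq_zero_of_coprime_nsmul
        ((Nat.coprime_primes Nat.prime_three hp).mpr (by omega)) h3 (hI h)
      rw [Finset.sum_singleton, Finset.sum_eq_single 0]
      · simp
      · exact fun h hh h0 => absurd (h3 h (Finset.mem_filter.mp hh).2) h0
      · simp
    · simp only [hI, Finset.filter_true]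
      exact Fintype.sum_bijective _ (Finite.injective_iff_bijective.mp h2) _ _ fun _ => rfl
    · omega

end Reduction

/-! ### Symmetric powers -/

section SymmetricPowers

variable {F V I : Type*} [Field F] [AddCommGroup V] [Module F V]

theorem SymmetricAlgebra.ι_basis_ne_zero (e : Module.Basis I F V) (i : I) :
    SymmetricAlgebra.ι F V (e i) ≠ 0 := fun h => by
  have := SymmetricAlgebra.equivMvPolynomial_ι_apply e i
  rw [h, map_zero] at this
  exact MvPolynomial.X_ne_zero i this.symm

theorem finiteDimensional_range_pow {A : Type*} [FiniteDimensional F V] [Ring A] [Algebra F A]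
    (l : V →ₗ[F] A) (k : ℕ) : FiniteDimensional F ↥(LinearMap.range l ^ k) :=
  Module.Finite.iff_fg.mpr ((Module.Finite.iff_fg.mp inferInstance).pow k)

variable [IsAlgClosed F] [FiniteDimensional F V] [AddCommGroup I] [Fintype I]

theorem reducibleOver_symRep_of_normalizesWeyl {p : ℕ} (hp : p.Prime)
    (hpF : (p : F) ≠ 0) (hI : ∀ i : I, p • i = 0)
    (hsep : ∀ i : I, i ≠ 0 → ∃ χ : AddChar I F, χ i ≠ 1) (e : Module.Basis I F V)
    (hcard : 4 < Fintype.card I) {k : ℕ} (hk : 2 < p ∧ 2 < k ∨ p = 2 ∧ 3 < k)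
    {G : Subgroup (LinearMap.GeneralLinearGroup F V)} (hG : ∀ g ∈ G, NormalizesWeyl e g) :
    ReducibleOver (symRep F V k) G := by
  have hfin := finiteDimensional_range_pow (symFunctorialAlgebra F V).ι k
  obtain ⟨a, ha⟩ : ∃ a : I, a ≠ 0 := by
    have : Nontrivial I := Fintype.one_lt_card_iff_nontrivial.mp (by omega)
    exact exists_ne 0
  have hι : ∀ i, (symFunctorialAlgebra F V).ι (e i) ≠ 0 := SymmetricAlgebra.ι_basis_ne_zero e
  by_cases hp5 : 5 ≤ p
  · -- Move `a, a, -2a` to `-a, -a, 2a`; the other factors are `e 0`.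
    have hne : ∀ m : ℕ, 0 < m → m < p → m • a ≠ 0 := fun m hm0 hmp h =>
      ha (eq_zero_of_coprime_nsmul (Nat.coprime_of_lt_prime hm0.ne' hmp hp) (hI a) h)
    have h2 := hne 2 (by omega) (by omega)
    have h3 := hne 3 (by omega) (by omega)
    have h4 := hne 4 (by omega) (by omega)
    refine (symFunctorialAlgebra F V).reducibleOver_of_normalizesWeyl hp hpF hI hsep e
      (symRep F V k) (coe_symRep F V k) hG (Or.inl ⟨hp5, rfl, rfl⟩) [a, a, -(2 • a)]
      (List.replicate (k - 3) 0) rfl (by simp [two_nsmul]) (by simp; omega)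
      {i | i ≠ a ∧ i ≠ -(2 • a)} (by simp) ?_ ?_
    · intro i hi
      rw [List.eq_of_mem_replicate hi]
      exact ⟨ha.symm, fun h => h2 (by simpa using h.symm)⟩
    · have hm1 : -a ∈ {i | i ≠ a ∧ i ≠ -(2 • a)} :=
        ⟨fun h => h2 (by rw [two_nsmul]; nth_rw 1 [← h]; simp),
          fun h => ha (by rw [neg_inj, two_nsmul] at h; simpa using h)⟩
      have hm2 : 2 • a ∈ {i | i ≠ a ∧ i ≠ -(2 • a)} :=
        ⟨fun h => ha (by rw [two_nsmul] at h; simpa using h),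
          fun h => h4 (by rw [show 4 • a = 2 • a + 2 • a by module]; nth_rw 1 [h]; simp)⟩
      simp only [Finset.sum_singleton, List.map_cons, List.map_nil, List.prod_cons, List.prod_nil,
        zero_sub, neg_neg, coordProj_of_mem e hm1, coordProj_of_mem e hm2, List.map_replicate,
        List.prod_replicate, mul_one]
      exact mul_ne_zero (mul_ne_zero (hι _) (mul_ne_zero (hι _) (hι _))) (pow_ne_zero _ (hι _))
  · -- Move `0, …, 0` to `a, …, a`; the other factors are `e a` as well.
    obtain ⟨r, hr, hrk, hrp⟩ : ∃ r, (p = 3 ∧ r = 3 ∨ p = 2 ∧ r = 4) ∧ r ≤ k ∧ r ≠ 0 := by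
      have hp4 : p ≠ 4 := by rintro rfl; exact absurd hp (by decide)
      rcases hk with h | h
      · exact ⟨3, Or.inl ⟨by omega, rfl⟩, by omega, by omega⟩
      · exact ⟨4, Or.inr ⟨by omega, rfl⟩, by omega, by omega⟩
    refine (symFunctorialAlgebra F V).reducibleOver_of_normalizesWeyl hp hpF hI hsep e
      (symRep F V k) (coe_symRep F V k) hG (r := r) (H := Finset.univ) (by tauto)
      (List.replicate r 0) (List.replicate (k - r) a) (by simp) (by simp) (by simp; omega)
      {a} ?_ ?_ ?_
    · intro i hi
      rw [List.eq_of_mem_replicate hi]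
      exact ha.symm
    · exact fun i hi => List.eq_of_mem_replicate hi
    · simp only [List.map_replicate, List.prod_replicate, sub_zero]
      rw [Finset.sum_eq_single a]
      · rw [coordProj_of_mem e (Set.mem_singleton a)]
        exact mul_ne_zero (pow_ne_zero _ (hι _)) (pow_ne_zero _ (hι _))
      · intro h _ hh
        rw [coordProj_of_notMem e (show h ∉ ({a} : Set I) from hh), map_zero, zero_pow hrp]
      · simp

end SymmetricPowers

/-! ### Products of basis vectors in the exterior algebra -/

section Avoiding

variable {I : Type*} [Fintype I]

theorem exists_nodup_list_avoiding (S : Finset I) {m : ℕ} (hm : m + S.card ≤ Fintype.card I) :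
    ∃ R : List I, R.length = m ∧ R.Nodup ∧ ∀ i ∈ R, i ∉ S := by
  classical
  obtain ⟨T, hT, hTm⟩ := Finset.exists_subset_card_eq
    (show m ≤ Sᶜ.card by rw [Finset.card_compl]; omega)
  exact ⟨T.toList, by simp [hTm], T.nodup_toList,
    fun i hi => Finset.mem_compl.mp (hT (Finset.mem_toList.mp hi))⟩

theorem exists_notMem_of_card_lt (S : Finset I) (h : S.card < Fintype.card I) : ∃ i, i ∉ S := by
  by_contra! hall
  rw [← Finset.card_univ, ← Finset.eq_univ_iff_forall.mpr hall] at h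
  exact h.ne rfl

end Avoiding

section ExteriorPowers

variable {F V I : Type*} [Field F] [AddCommGroup V] [Module F V]

theorem extProd_eq_ιMulti (e : I → V) (l : List I) :
    (l.map fun i => ExteriorAlgebra.ι F (e i)).prod =
      ExteriorAlgebra.ιMulti F l.length fun j => e (l.get j) := by
  rw [ExteriorAlgebra.ιMulti_apply]
  congr 1
  conv_lhs => rw [← List.ofFn_get l, List.map_ofFn]
  rfl

theorem extProd_eq_zero (e : I → V) {l : List I} (hl : ¬ l.Nodup) :
    (l.map fun i => ExteriorAlgebra.ι F (e i)).prod = 0 := by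
  rw [extProd_eq_ιMulti]
  refine ExteriorAlgebra.ιMulti_eq_zero_of_not_inj fun hinj => hl ?_
  rw [List.nodup_iff_injective_get]
  exact Function.Injective.of_comp hinj

theorem extProd_ne_zero (e : Module.Basis I F V) {l : List I} (hl : l.Nodup) :
    (l.map fun i => ExteriorAlgebra.ι F (e i)).prod ≠ 0 := by
  classical
  rw [extProd_eq_ιMulti]
  intro h
  let f : V →ₗ[F] (Fin l.length → F) := e.constr F fun i j => if l.get j = i then 1 else 0
  let D := (Matrix.detRowAlternating (R := F) (n := Fin l.length)).compLinearMap f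
  have h1 := exteriorPower.alternatingMapLinearEquiv_apply_ιMulti D fun j => e (l.get j)
  rw [show exteriorPower.ιMulti F l.length (fun j => e (l.get j)) = 0 from Subtype.ext h,
    map_zero] at h1
  have h2 : (fun j => f (e (l.get j))) = (1 : Matrix (Fin l.length) (Fin l.length) F) := by
    ext j j'
    simp only [f, Module.Basis.constr_basis, Matrix.one_apply]
    rw [(List.nodup_iff_injective_get.mp hl).eq_iff]
    simp only [eq_comm]
  have h3 : D (fun j => e (l.get j)) = 1 := by
    change Matrix.detRowAlternating (fun j => f (e (l.get j))) = 1
    rw [h2]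
    exact Matrix.det_one
  exact zero_ne_one (h1.trans h3)

theorem ExteriorAlgebra.ι_mul_ι_comm (x y : V) :
    ExteriorAlgebra.ι F x * ExteriorAlgebra.ι F y =
      -(ExteriorAlgebra.ι F y * ExteriorAlgebra.ι F x) :=
  eq_neg_of_add_eq_zero_left (ExteriorAlgebra.ι_add_mul_swap x y)

theorem ExteriorAlgebra.ι_mul_ι_mul_ι_rotate (x y z : V) :
    ExteriorAlgebra.ι F z * (ExteriorAlgebra.ι F x * ExteriorAlgebra.ι F y) =
      ExteriorAlgebra.ι F x * (ExteriorAlgebra.ι F y * ExteriorAlgebra.ι F z) := by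
  rw [← mul_assoc, ι_mul_ι_comm z x, neg_mul, mul_assoc, ι_mul_ι_comm z y, mul_neg, neg_neg]

variable [AddCommGroup I] [Fintype I]

/-- For a list `Q` whose translates `h - Q`, `h ∈ C`, all have the same exterior product and lie
in `C`, the remaining reflections contribute nothing: they produce a repeated factor. -/
theorem extProd_sum_ne_zero (e : Module.Basis I F V) (Q R : List I) (C : Finset I)
    (h0 : (0 : I) ∈ Q) (hCQ : ∀ h ∈ C, ∀ q ∈ Q, h - q ∈ C) {h₀ : I}
    (heq : ∀ h ∈ C, (Q.map fun q => ExteriorAlgebra.ι F (e (h - q))).prod =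
      (Q.map fun q => ExteriorAlgebra.ι F (e (h₀ - q))).prod)
    (hC : (C.card : F) ≠ 0) (hnd : (Q.map (h₀ - ·) ++ R).Nodup) :
    (∑ h : I, (Q.map fun q =>
        ExteriorAlgebra.ι F (coordProj e {i | i ∈ C ∨ i ∈ R} (e (h - q)))).prod) *
      (R.map fun i => ExteriorAlgebra.ι F (e i)).prod ≠ 0 := by
  set K : Set I := {i | i ∈ C ∨ i ∈ R}
  have hin : ∀ h, (∀ q ∈ Q, h - q ∈ K) →
      (Q.map fun q => ExteriorAlgebra.ι F (coordProj e K (e (h - q)))).prod =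
        (Q.map fun q => ExteriorAlgebra.ι F (e (h - q))).prod := fun h hK => by
    congr 1
    exact List.map_congr_left fun q hq => by rw [coordProj_of_mem e (hK q hq)]
  have hout : ∀ h ∉ C, (Q.map fun q => ExteriorAlgebra.ι F (coordProj e K (e (h - q)))).prod *
      (R.map fun i => ExteriorAlgebra.ι F (e i)).prod = 0 := fun h hh => by
    by_cases hK : ∀ q ∈ Q, h - q ∈ K
    · have hR : h ∈ R := by
        have := hK 0 h0
        rw [sub_zero] at this
        exact this.resolve_left hh
      have hdup : ¬ (Q.map (h - ·) ++ R).Nodup := fun hn =>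
        (List.disjoint_of_nodup_append hn) (List.mem_map.mpr ⟨0, h0, sub_zero h⟩) hR
      have := extProd_eq_zero (F := F) e hdup
      rwa [List.map_append, List.prod_append, List.map_map, Function.comp_def, ← hin h hK] at this
    · push Not at hK
      obtain ⟨q, hq, hqK⟩ := hK
      rw [List.prod_eq_zero (List.mem_map.mpr ⟨q, hq, ?_⟩), zero_mul]
      rw [coordProj_of_notMem e hqK, map_zero]
  rw [Finset.sum_mul, ← Finset.sum_subset (Finset.subset_univ C) fun h _ hh => hout h hh,
    Finset.sum_congr rfl fun h hh => by
      rw [hin h fun q hq => Or.inl (hCQ h hh q hq), heq h hh],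
    Finset.sum_const, ← Nat.cast_smul_eq_nsmul F]
  refine smul_ne_zero hC ?_
  have := extProd_ne_zero e hnd
  rwa [List.map_append, List.prod_append, List.map_map, Function.comp_def] at this

end ExteriorPowers

/-! ### Exterior powers -/

section ExteriorReducibility

variable {F V I : Type*} [Field F] [AddCommGroup V] [Module F V] [AddCommGroup I]

theorem neg_notMem_of_sum_eq_zero {x y z : I} (h2 : ∀ i : I, i + i = 0 → i = 0)
    (hs : x + y + z = 0) (hx : x ≠ 0) (hy : y ≠ 0) (hz : z ≠ 0) :
    ∀ q ∈ [x, y, z], -q ∉ [x, y, z] := by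
  have key : ∀ q q' : I, -q = q' → q + q' = 0 := fun q q' h => by rw [← h, add_neg_cancel]
  have hxy : x + y ≠ 0 := fun h => hz (by simpa [h] using hs)
  have hxz : x + z ≠ 0 := fun h => hy (by rw [add_right_comm, h, zero_add] at hs; exact hs)
  have hyz : y + z ≠ 0 := fun h => hx (by rw [add_assoc, h, add_zero] at hs; exact hs)
  have hxx : x + x ≠ 0 := fun h => hx (h2 x h)
  have hyy : y + y ≠ 0 := fun h => hy (h2 y h)
  have hzz : z + z ≠ 0 := fun h => hz (h2 z h)
  intro q hq hq'
  simp only [List.mem_cons, List.not_mem_nil, or_false] at hq hq'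
  rcases hq with rfl | rfl | rfl <;> rcases hq' with h | h | h <;> have h' := key _ _ h <;>
    first
      | exact absurd h' ‹_›
      | exact absurd ((add_comm _ _).trans h') ‹_›

variable [Fintype I]

/-- For `p ≥ 5`, three indices with sum zero that are disjoint from their negatives, and further
indices disjoint from both. -/
theorem exists_triple_avoiding_negatives {p : ℕ} (hp : p.Prime) (hp2 : p ≠ 2)
    (hI : ∀ i : I, p • i = 0) {m : ℕ} (hm : m + 6 ≤ Fintype.card I) :
    ∃ Q R : List I, Q.length = 3 ∧ Q.sum = 0 ∧ R.length = m ∧ (∀ q ∈ Q, -q ∉ Q) ∧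
      (∀ i ∈ R, i ∉ Q) ∧ (Q.map (-·) ++ R).Nodup := by
  classical
  have h2 : ∀ i : I, i + i = 0 → i = 0 := fun i hi =>
    eq_zero_of_coprime_nsmul ((Nat.coprime_primes Nat.prime_two hp).mpr hp2.symm)
      (by rwa [two_nsmul]) (hI i)
  obtain ⟨c, hc⟩ : ∃ c : I, c ≠ 0 := by
    have : Nontrivial I := Fintype.one_lt_card_iff_nontrivial.mp (by omega)
    exact exists_ne 0
  obtain ⟨y, hy⟩ := exists_notMem_of_card_lt {0, c + c, -(c + c), -(c + c + (c + c)), -c}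
    (Finset.card_le_five.trans_lt (show 5 < Fintype.card I by omega))
  simp only [Finset.mem_insert, Finset.mem_singleton, not_or] at hy
  obtain ⟨hy0, hyx, hyz, hyxx, hyc⟩ := hy
  -- With `x = 2c`, the condition `y ≠ -x - y` reads `2(y + c) ≠ 0`, that is `y ≠ -c`.
  obtain ⟨x, hx⟩ : ∃ x, x = c + c := ⟨_, rfl⟩
  obtain ⟨z, hz⟩ : ∃ z, z = -(c + c + y) := ⟨_, rfl⟩
  have hx0 : x ≠ 0 := fun h => hc (h2 c (hx ▸ h))
  have hz0 : z ≠ 0 := fun h => hyz (eq_neg_of_add_eq_zero_right (neg_eq_zero.mp (hz ▸ h)))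
  have hs : x + y + z = 0 := by rw [hx, hz]; abel
  have hxy : x ≠ y := fun h => hyx (by rw [← h, hx])
  have hxz : x ≠ z := fun h => hyxx (by
    rw [hx, hz, eq_neg_iff_add_eq_zero] at h
    rw [eq_neg_iff_add_eq_zero, ← h]
    abel)
  have hyz' : y ≠ z := fun h => hyc (by
    rw [hz, eq_neg_iff_add_eq_zero] at h
    rw [eq_neg_iff_add_eq_zero]
    exact h2 _ (by rw [← h]; abel))
  obtain ⟨R, hRm, hRn, hR⟩ := exists_nodup_list_avoiding {x, y, z, -x, -y, -z} (m := m)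
    ((Nat.add_le_add_left Finset.card_le_six m).trans hm)
  simp only [Finset.mem_insert, Finset.mem_singleton, not_or] at hR
  refine ⟨[x, y, z], R, rfl, by rw [← hs]; simp [add_assoc], hRm,
    neg_notMem_of_sum_eq_zero h2 hs hx0 hy0 hz0, ?_, ?_⟩
  · intro i hi
    simp [hR i hi]
  · rw [List.nodup_append]
    refine ⟨by simp [hxy, hxz, hyz'], hRn, fun a ha b hb hab => ?_⟩
    have := hR b hb
    rw [← hab] at this
    simp only [List.map_cons, List.map_nil, List.mem_cons, List.not_mem_nil, or_false] at ha
    tauto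

variable [IsAlgClosed F] [FiniteDimensional F V]

/-- For `p ≥ 5` three factors move from `Q` to `-Q`, and the projection kills exactly the factors
in `Q`; avoiding `Q` and `-Q` with the other `k - 3` factors requires `k + 3 ≤ d`. -/
theorem reducibleOver_extRep_of_five_le {p : ℕ} (hp : p.Prime) (hp5 : 5 ≤ p)
    (hpF : (p : F) ≠ 0) (hI : ∀ i : I, p • i = 0)
    (hsep : ∀ i : I, i ≠ 0 → ∃ χ : AddChar I F, χ i ≠ 1) (e : Module.Basis I F V)
    {k : ℕ} (hk : 2 < k) (hkd : k + 2 < Fintype.card I)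
    {G : Subgroup (LinearMap.GeneralLinearGroup F V)} (hG : ∀ g ∈ G, NormalizesWeyl e g) :
    ReducibleOver (extRep F V k) G := by
  have hfin := finiteDimensional_range_pow (extFunctorialAlgebra F V).ι k
  obtain ⟨Q, R, hQ3, hQ0, hRk, hQn, hRQ, hnd⟩ := exists_triple_avoiding_negatives hp (by omega)
    hI (m := k - 3) (by omega)
  refine (extFunctorialAlgebra F V).reducibleOver_of_normalizesWeyl hp hpF hI hsep e
    (extRep F V k) (coe_extRep F V k) hG (Or.inl ⟨hp5, rfl, rfl⟩) Q R hQ3 hQ0 (by omega)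
    {i | i ∉ Q} (fun q hq h => h hq) hRQ ?_
  have h := extProd_ne_zero e hnd
  rw [List.map_append, List.prod_append, List.map_map] at h
  refine ne_of_eq_of_ne (congrArg₂ (· * ·) ?_ rfl) h
  rw [Finset.sum_singleton]
  congr 1
  refine List.map_congr_left fun q hq => ?_
  rw [zero_sub, coordProj_of_mem e (show -q ∈ {i | i ∉ Q} from hQn q hq)]
  rfl

/-- For `p ≤ 3` the indices of the moved factors form a subgroup of `I`, listed in `Q`, and they
are moved to a nontrivial coset. All translations by the subgroup give the same exterior product,
so that the terms do not cancel. -/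
theorem reducibleOver_extRep_of_subgroup {p : ℕ} (hp : p.Prime) (hpF : (p : F) ≠ 0)
    (hI : ∀ i : I, p • i = 0) (hsep : ∀ i : I, i ≠ 0 → ∃ χ : AddChar I F, χ i ≠ 1)
    (e : Module.Basis I F V) {k r : ℕ} (hpr : p = 3 ∧ r = 3 ∨ p = 2 ∧ r = 4) (hk : r ≤ k)
    (hkd : k + r ≤ Fintype.card I) {Q : List I} (hQr : Q.length = r) (hQs : Q.sum = 0)
    (hQn : Q.Nodup) (hQ0 : (0 : I) ∈ Q) (hadd : ∀ q ∈ Q, ∀ q' ∈ Q, q + q' ∈ Q)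
    (heq : ∀ b, ∀ s ∈ Q, (Q.map fun q => ExteriorAlgebra.ι F (e (b - s - q))).prod =
      (Q.map fun q => ExteriorAlgebra.ι F (e (b - q))).prod)
    {G : Subgroup (LinearMap.GeneralLinearGroup F V)} (hG : ∀ g ∈ G, NormalizesWeyl e g) :
    ReducibleOver (extRep F V k) G := by
  classical
  have hfin := finiteDimensional_range_pow (extFunctorialAlgebra F V).ι k
  obtain ⟨b, hb⟩ := exists_notMem_of_card_lt Q.toFinset
    (Q.toFinset_card_le.trans_lt (by omega))
  rw [List.mem_toFinset] at hb
  let C : Finset I := (Q.map (b - ·)).toFinset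
  have hC : ∀ i, i ∈ C ↔ ∃ q ∈ Q, b - q = i := fun i => by simp [C]
  have hCn : (Q.map (b - ·)).Nodup := hQn.map sub_right_injective
  have hCcard : (C.card : F) ≠ 0 := by
    rw [List.toFinset_card_of_nodup hCn, List.length_map, hQr]
    rcases hpr with ⟨rfl, rfl⟩ | ⟨rfl, rfl⟩
    · exact hpF
    · rw [show 4 = 2 * 2 from rfl, Nat.cast_mul]
      exact mul_ne_zero hpF hpF
  obtain ⟨R, hRm, hRn, hR⟩ := exists_nodup_list_avoiding (Q.toFinset ∪ C) (m := k - r) (by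
    have h1 := Finset.card_union_le Q.toFinset C
    have h2 := Q.toFinset_card_le
    have h3 := (Q.map (b - ·)).toFinset_card_le
    rw [List.length_map] at h3
    change C.card ≤ _ at h3
    omega)
  refine (extFunctorialAlgebra F V).reducibleOver_of_normalizesWeyl (r := r)
    hp hpF hI hsep e (extRep F V k) (coe_extRep F V k) hG (H := Finset.univ) (by tauto) Q R hQr
    hQs (by omega) {i | i ∈ C ∨ i ∈ R} ?_ (fun i hi => Or.inr hi)
    (extProd_sum_ne_zero e Q R C hQ0 ?_ (h₀ := b) ?_ hCcard ?_)
  · rintro q hq (h | h)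
    · obtain ⟨q', hq', rfl⟩ := (hC q).mp h
      have := hadd _ hq _ hq'
      rw [sub_add_cancel] at this
      exact hb this
    · exact hR q h (Finset.mem_union_left _ (List.mem_toFinset.mpr hq))
  · intro h hh q hq
    obtain ⟨q', hq', rfl⟩ := (hC h).mp hh
    exact (hC _).mpr ⟨q' + q, hadd _ hq' _ hq, by abel⟩
  · intro h hh
    obtain ⟨s, hs, rfl⟩ := (hC h).mp hh
    exact heq b s hs
  · rw [List.nodup_append]
    refine ⟨hCn, hRn, fun i hi j hj hij => hR j hj (Finset.mem_union_right _ ?_)⟩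
    rw [← hij]
    exact List.mem_toFinset.mpr hi

/-- The subgroup is the line through `c`; its translations permute three factors cyclically, which
is an even permutation. -/
theorem reducibleOver_extRep_of_eq_three (hpF : (3 : F) ≠ 0) (hI : ∀ i : I, 3 • i = 0)
    (hsep : ∀ i : I, i ≠ 0 → ∃ χ : AddChar I F, χ i ≠ 1) (e : Module.Basis I F V)
    {k : ℕ} (hk : 2 < k) (hkd : k + 2 < Fintype.card I)
    {G : Subgroup (LinearMap.GeneralLinearGroup F V)} (hG : ∀ g ∈ G, NormalizesWeyl e g) :
    ReducibleOver (extRep F V k) G := by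
  have h3 : ∀ i : I, i + i = -i := fun i => by
    rw [eq_neg_iff_add_eq_zero, ← hI i]
    module
  obtain ⟨c, hc⟩ : ∃ c : I, c ≠ 0 := by
    have : Nontrivial I := Fintype.one_lt_card_iff_nontrivial.mp (by omega)
    exact exists_ne 0
  have hcc : c ≠ -c := fun h => hc (by rw [← h3 c] at h; simpa using h)
  refine reducibleOver_extRep_of_subgroup (p := 3) Nat.prime_three (by exact_mod_cast hpF) hI hsep
    e (r := 3) (by simp) hk hkd (Q := [0, c, -c]) rfl (by simp) (by simp [hc, hc.symm, hcc])
    (by simp) (by simp [h3]) ?_ hG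
  intro b s hs
  have h1 : b - c - c = b + c := by rw [sub_sub, h3, sub_neg_eq_add]
  have h2 : b + c + c = b - c := by rw [add_assoc, h3, sub_eq_add_neg]
  simp only [List.mem_cons, List.not_mem_nil, or_false] at hs
  simp only [List.map_cons, List.map_nil, List.prod_cons, List.prod_nil, mul_one, sub_zero,
    sub_neg_eq_add]
  rcases hs with rfl | rfl | rfl
  · simp
  · rw [h1, sub_add_cancel, ← ExteriorAlgebra.ι_mul_ι_mul_ι_rotate]
  · rw [sub_neg_eq_add, add_sub_cancel_right, h2, ExteriorAlgebra.ι_mul_ι_mul_ι_rotate]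

/-- The subgroup is a plane `{0, u, v, u + v}`; its translations permute four factors by double
transpositions, which are even. -/
theorem reducibleOver_extRep_of_eq_two (hpF : (2 : F) ≠ 0) (hI : ∀ i : I, 2 • i = 0)
    (hsep : ∀ i : I, i ≠ 0 → ∃ χ : AddChar I F, χ i ≠ 1) (e : Module.Basis I F V)
    {k : ℕ} (hk : 3 < k) (hkd : k + 3 < Fintype.card I)
    {G : Subgroup (LinearMap.GeneralLinearGroup F V)} (hG : ∀ g ∈ G, NormalizesWeyl e g) :
    ReducibleOver (extRep F V k) G := by
  classical
  have h2 : ∀ i : I, i + i = 0 := fun i => by rw [← two_nsmul, hI]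
  obtain ⟨u, hu⟩ : ∃ u : I, u ≠ 0 := by
    have : Nontrivial I := Fintype.one_lt_card_iff_nontrivial.mp (by omega)
    exact exists_ne 0
  obtain ⟨v, hv⟩ := exists_notMem_of_card_lt {0, u}
    (Finset.card_le_two.trans_lt (show 2 < Fintype.card I by omega))
  simp only [Finset.mem_insert, Finset.mem_singleton, not_or] at hv
  have huv : u + v ≠ 0 := fun h => hv.2 (by
    rw [← h2 u] at h
    exact add_left_cancel h)
  have h2' : ∀ i j : I, i + (i + j) = j := fun i j => by rw [← add_assoc, h2, zero_add]
  refine reducibleOver_extRep_of_subgroup (p := 2) Nat.prime_two (by exact_mod_cast hpF) hI hsep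
    e (r := 4) (by simp) hk hkd (Q := [0, u, v, u + v]) rfl ?_
    (by simp [hu, hu.symm, hv.1, Ne.symm hv.1, Ne.symm hv.2, huv.symm])
    (by simp) ?_ ?_ hG
  · simp only [List.sum_cons, List.sum_nil, zero_add, add_zero]
    rw [← add_assoc, h2]
  · have h5 : v + (u + v) = u := by rw [add_comm u v, h2']
    have h6 : u + v + u = v := by rw [add_comm, h2']
    have h7 : u + v + v = u := by rw [add_assoc, h2, add_zero]
    simp [h2, h2', h5, h6, h7, add_comm v u]
  · intro b s hs
    have swap : ∀ x y z w : V, ExteriorAlgebra.ι F y * (ExteriorAlgebra.ι F x *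
        (ExteriorAlgebra.ι F w * ExteriorAlgebra.ι F z)) =
        ExteriorAlgebra.ι F x * (ExteriorAlgebra.ι F y *
        (ExteriorAlgebra.ι F z * ExteriorAlgebra.ι F w)) := fun x y z w => by
      rw [ExteriorAlgebra.ι_mul_ι_comm w z, ← mul_assoc, ExteriorAlgebra.ι_mul_ι_comm y x,
        mul_neg, neg_mul, neg_neg, mul_assoc]
    have pair : ∀ x y z w : V, ExteriorAlgebra.ι F z * (ExteriorAlgebra.ι F w *
        (ExteriorAlgebra.ι F x * ExteriorAlgebra.ι F y)) =
        ExteriorAlgebra.ι F x * (ExteriorAlgebra.ι F y *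
        (ExteriorAlgebra.ι F z * ExteriorAlgebra.ι F w)) := fun x y z w => by
      rw [ExteriorAlgebra.ι_mul_ι_mul_ι_rotate x y w, ← mul_assoc (ExteriorAlgebra.ι F x),
        ← mul_assoc, ExteriorAlgebra.ι_mul_ι_mul_ι_rotate x y z]
      simp only [mul_assoc]
    have h5 : v + (u + v) = u := by rw [add_comm u v, h2']
    have h6 : u + v + u = v := by rw [add_comm, h2']
    have h7 : u + v + v = u := by rw [add_assoc, h2, add_zero]
    simp only [List.mem_cons, List.not_mem_nil, or_false] at hs
    simp only [List.map_cons, List.map_nil, List.prod_cons, List.prod_nil, mul_one, sub_zero]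
    rcases hs with rfl | rfl | rfl | rfl
    · simp only [sub_zero]
    · simp only [sub_sub, h2, h2', sub_zero]
      rw [swap]
    · simp only [sub_sub, h2, h5, add_comm s u, sub_zero]
      rw [pair]
    · simp only [sub_sub, h2, h6, h7, sub_zero]
      rw [pair, swap]

end ExteriorReducibility

/-! ### Normalizers of extraspecial groups -/

section Normalizers

variable {F V I : Type*} [Field F] [AddCommGroup V] [Module F V] [AddCommGroup I]

/-- Only scalars commute with all Weyl operators: the diagonal ones make `e 0` an eigenvector, and
the translations carry its eigenvalue to the other basis vectors. -/
theorem exists_eq_smul_one_of_commute_weylOp (e : Module.Basis I F V)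
    (hsep : ∀ i : I, i ≠ 0 → ∃ χ : AddChar I F, χ i ≠ 1) {f : Module.End F V}
    (hf : ∀ χ b, f * weylOp e χ b = weylOp e χ b * f) : ∃ a : F, f = a • 1 := by
  have happ : ∀ χ b v, f (weylOp e χ b v) = weylOp e χ b (f v) := fun χ b v =>
    LinearMap.congr_fun (hf χ b) v
  have h0 : f (e 0) = e.repr (f (e 0)) 0 • e 0 := by
    refine e.repr.injective (Finsupp.ext fun i => ?_)
    by_cases hi : i = 0
    · simp [hi]
    · obtain ⟨χ, hχ⟩ := hsep i hi
      have h := congrArg (fun v => e.repr v i) (happ χ 0 (e 0))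
      simp only [weylOp_apply, AddChar.map_zero_eq_one, one_smul, add_zero, repr_weylOp_zero] at h
      have h1 : (χ i - 1) * e.repr (f (e 0)) i = 0 := by rw [sub_mul, one_mul, ← h, sub_self]
      rw [(mul_eq_zero.mp h1).resolve_left (sub_ne_zero.mpr hχ)]
      simp [Ne.symm hi]
  refine ⟨e.repr (f (e 0)) 0, e.ext fun i => ?_⟩
  have h := happ 1 i (e 0)
  rw [h0] at h
  simpa using h

end Normalizers

section Assembly

universe u v

variable {F : Type u} {V : Type v} [Field F] [IsAlgClosed F] [AddCommGroup V] [Module F V]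
  [FiniteDimensional F V]

theorem centerOf_le_centralizer {M : Type*} [Group M] {K P : Subgroup M} (hPK : P ≤ K) :
    centerOf K ≤ Subgroup.centralizer (P : Set M) := by
  rintro _ ⟨z, hz, rfl⟩
  exact Subgroup.mem_centralizer_iff.mpr fun x hx =>
    congrArg Subtype.val (Subgroup.mem_center_iff.mp hz ⟨x, hPK hx⟩)

theorem le_normalizer_of_centerOf_sup_eq {M : Type*} [Group M] {K G H P : Subgroup M}
    (hPK : P ≤ K) (hGH : centerOf K ⊔ G = centerOf K ⊔ H)
    (hHP : H ≤ Subgroup.normalizer (P : Set M)) : G ≤ Subgroup.normalizer (P : Set M) :=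
  (le_sup_right.trans hGH.le).trans
    (sup_le ((centerOf_le_centralizer hPK).trans (Subgroup.centralizer_le_normalizer _)) hHP)

/-- The central elements of `P` commute with the Weyl operators and are scalars, so `P` consists of
multiples of Weyl operators; since `G` normalizes `P`, it permutes these up to scalars. -/
theorem NormalizesExtraspecial.exists_basis {p : ℕ} (hp : p.Prime) (hpF : (p : F) ≠ 0)
    {𝒢 G : Subgroup (LinearMap.GeneralLinearGroup F V)} (h : NormalizesExtraspecial p 𝒢 G) :
    ∃ (I : Type v) (_ : AddCommGroup I) (_ : Fintype I) (e : Module.Basis I F V),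
      (∀ i : I, p • i = 0) ∧ (∀ i : I, i ≠ 0 → ∃ χ : AddChar I F, χ i ≠ 1) ∧
      ∀ g ∈ G, NormalizesWeyl e g := by
  obtain ⟨H, P, E, -, hGH, -, hP𝒢, hHP, hEP, hPE, hE, hd⟩ := h
  have hGP := le_normalizer_of_centerOf_sup_eq hP𝒢 hGH hHP
  let τ : E →* Module.End F V := (Units.coeHom (Module.End F V)).comp E.subtype
  have hτ : Function.Injective τ := Units.val_injective.comp Subtype.val_injective
  obtain ⟨I, _, _, e, hI, hsep, hweyl, hlift⟩ := hE.exists_weyl_basis hp hpF hτ hd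
  refine ⟨I, inferInstance, inferInstance, e, hI, hsep, fun g hg χ b => ?_⟩
  have hcenter : ∀ z ∈ centerOf P, ∃ a : F, ((z : LinearMap.GeneralLinearGroup F V) :
      Module.End F V) = a • 1 := by
    intro z hz
    refine exists_eq_smul_one_of_commute_weylOp e hsep fun χ b => ?_
    obtain ⟨x, k, hk, hx⟩ := hlift χ b
    have hzx : z * x = x * z :=
      (Subgroup.mem_centralizer_iff.mp (centerOf_le_centralizer le_rfl hz) x (hEP x.2)).symm
    refine smul_right_injective _ hk ?_
    simp only
    rw [← mul_smul_comm, ← smul_mul_assoc, ← hx]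
    exact congrArg Units.val hzx
  have hPweyl : ∀ y ∈ P, ∃ (k : F) (χ : AddChar I F) (b : I),
      ((y : LinearMap.GeneralLinearGroup F V) : Module.End F V) = k • weylOp e χ b := by
    intro y hy
    have hn : E ≤ Subgroup.normalizer (centerOf P : Set (LinearMap.GeneralLinearGroup F V)) :=
      (hEP.trans (Subgroup.le_centralizer_iff.mp (centerOf_le_centralizer le_rfl))).trans
        (Subgroup.centralizer_le_normalizer _)
    rw [hPE, ← SetLike.mem_coe, Subgroup.coe_mul_of_right_le_normalizer_left _ _ hn] at hy
    obtain ⟨z, hz, x, hx, rfl⟩ := hy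
    obtain ⟨a, ha⟩ := hcenter z hz
    obtain ⟨k, χ, b, -, h⟩ := hweyl ⟨x, hx⟩
    refine ⟨a * k, χ, b, ?_⟩
    rw [mul_smul, ← h]
    simp only [Units.val_mul, ha, smul_mul_assoc, one_mul]
    rfl
  obtain ⟨x, k, hk, hx⟩ := hlift χ b
  have hgx : g⁻¹ * x * g ∈ P := by
    have := Subgroup.mem_normalizer_iff.mp (inv_mem (hGP hg)) x
    simpa using this.mp (hEP x.2)
  obtain ⟨k', χ', b', h'⟩ := hPweyl _ hgx
  refine ⟨k⁻¹ * k', χ', b', ?_⟩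
  rw [mul_smul, ← h', ← inv_smul_smul₀ hk (weylOp e χ b), ← hx, mul_smul_comm, smul_mul_assoc]
  rfl

end Assembly

theorem mainTheorem7 {F V : Type*} [Field F] [IsAlgClosed F] {ℓ : ℕ} [CharP F ℓ]
    [AddCommGroup V] [Module F V] [FiniteDimensional F V]
    (hd : 4 < Module.finrank F V)
    (𝒢 : Subgroup (LinearMap.GeneralLinearGroup F V)) (h𝒢 : IsClassicalGroup 𝒢)
    (G : Subgroup (LinearMap.GeneralLinearGroup F V)) (hG : G ≤ 𝒢)
    (p : ℕ) (hp : p.Prime) (hpℓ : p ≠ ℓ) (hE : NormalizesExtraspecial p 𝒢 G) (k : ℕ) :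
    ((2 < p ∧ 2 < k ∨ p = 2 ∧ 3 < k) → ReducibleOver (symRep F V k) G) ∧
    ((2 < p ∧ 2 < k ∧ k + 2 < Module.finrank F V ∨
        p = 2 ∧ 3 < k ∧ k + 3 < Module.finrank F V) →
      ReducibleOver (extRep F V k) G) := by
  have hpF : (p : F) ≠ 0 := fun h => by
    rw [CharP.cast_eq_zero_iff F ℓ] at h
    rcases (Nat.dvd_prime hp).mp h with h1 | h1
    · exact CharP.char_ne_one F ℓ h1
    · exact hpℓ h1.symm
  obtain ⟨I, _, _, e, hI, hsep, hGe⟩ := hE.exists_basis hp hpF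
  rw [Module.finrank_eq_card_basis e] at hd ⊢
  refine ⟨fun hk => reducibleOver_symRep_of_normalizesWeyl hp hpF hI hsep e hd hk hGe, ?_⟩
  rintro (⟨hp2, hk, hkd⟩ | ⟨rfl, hk, hkd⟩)
  · rcases eq_or_ne p 3 with rfl | hp3
    · exact reducibleOver_extRep_of_eq_three (by exact_mod_cast hpF) hI hsep e hk hkd hGe
    · have hp4 : p ≠ 4 := fun h => by rw [h] at hp; revert hp; decide
      exact reducibleOver_extRep_of_five_le hp (by omega) hpF hI hsep e hk hkd hGe
  · exact reducibleOver_extRep_of_eq_two (by exact_mod_cast hpF) hI hsep e hk hkd hGe
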